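/- Let $V$ be a vertex operator algebra. A $V$-module is a $\mathbb{C}$-graded space $W=\coprod_{n\in\mathbb{C}}W_{(n)}$ ($W_{(n)}$ being the eigenspace of $L(0)$ with eigenvalue $n$) satisfying the usual axioms (lower truncation, vacuum property, Jacobi identity, Virasoro relations, $L(-1)$-derivative property), with $\dim W_{(n)}<\infty$ and $W_{(n+k)}=0$ for $k\in\mathbb{Z}$ sufficiently negative, for each $n\in\mathbb{C}$. Its completion is $\overline{W}=\prod_{n\in\mathbb{C}}W_{(n)}$; a module map $\eta$ (a linear map commuting with the action of $V$ and preserving the gradings) extends naturally to a map $\overline{\eta}$ of completions. Assume that $V$ is *finitely reductive*: every $V$-module is completely reducible; up to equivalence there are only finitely many irreducible $V$-modules; and for all $V$-modules $W_1,W_2,W_3$ the space of (logarithmic) intertwining operators of type $\binom{W_3}{W_1W_2}$ is finite-dimensional. Fix $z\in\mathbb{C}$, $z\neq 0$. A *$P(z)$-intertwining map* of type $\binom{W_3}{W_1W_2}$ is a linear map $I:W_1\otimes W_2\to\overline{W_3}$ such that, for all $w_1\in W_1$, $w_2\in W_2$, $v\in V$: for each $n\in\mathbb{C}$ the weight-$(n-m)$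 component of $I(w_1\otimes w_2)$ vanishes for all sufficiently large $m\in\mathbb{N}$; $$x_0^{-1}\delta\Big(\frac{x_1-z}{x_0}\Big)Y_3(v,x_1)I(w_1\otimes w_2)=z^{-1}\delta\Big(\frac{x_1-x_0}{z}\Big)I(Y_1(v,x_0)w_1\otimes w_2)+x_0^{-1}\delta\Big(\frac{z-x_1}{-x_0}\Big)I(w_1\otimes Y_2(v,x_1)w_2);$$ and, for $j=-1,0,1$, $L(j)I(w_1\otimes w_2)=I(w_1\otimes L(j)w_2)+\sum_{i=0}^{j+1}\binom{j+1}{i}z^iI(L(j-i)w_1\otimes w_2)$. Let $\mathcal{M}_{W_1W_2}^{W_3}$ be the vector space of these maps. A *$P(z)$-tensor product* of $W_1$ and $W_2$ is a $V$-module $W_1\boxtimes_{P(z)}W_2$ together with a map $\boxtimes_{P(z)}\in\mathcal{M}_{W_1W_2}^{W_1\boxtimes_{P(z)}W_2}$ such that for every $V$-module $W$ and every $I\in\mathcal{M}_{W_1W_2}^{W}$ there is a unique module map $\eta:W_1\boxtimes_{P(z)}W_2\to W$ with $I=\overline{\eta}\circ\boxtimes_{P(z)}$. **Proposition.** Let $W_1$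 and $W_2$ be $V$-modules. Then a $P(z)$-tensor product of $W_1$ and $W_2$ exists. In fact, let $\{M_1,\dots,M_k\}$ be any set of representatives of the equivalence classes of irreducible $V$-modules. Then each $\mathcal{M}_{W_1W_2}^{M_i}$ is finite-dimensional, and $$W_1\boxtimes_{P(z)}W_2=\coprod_{i=1}^k(\mathcal{M}_{W_1W_2}^{M_i})^*\otimes M_i,$$ in which $V$ acts on the second tensor factors and the weight-$n$ subspace is $\coprod_{i}(\mathcal{M}_{W_1W_2}^{M_i})^*\otimes (M_i)_{(n)}$, is a $V$-module and is a $P(z)$-tensor product of $W_1$ and $W_2$, with $$\boxtimes_{P(z)}=\sum_{i=1}^k\mathcal{F}[P(z)]_{W_1W_2}^{M_i}.$$ Here $\mathcal{F}[P(z)]_{W_1W_2}^{W_3}:W_1\otimes W_2\to\operatorname{Hom}(\mathcal{M}_{W_1W_2}^{W_3},\overline{W_3})=(\mathcal{M}_{W_1W_2}^{W_3})^*\otimes\overline{W_3}=\overline{(\mathcal{M}_{W_1W_2}^{W_3})^*\otimes W_3}$ is the natural map sending $w_1\otimes w_2$ to $I\mapsto I(w_1\otimes w_2)$. -/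

import Mathlib

open scoped TensorProduct DirectSum

universe u v

noncomputable section

/-! ## Vertex operator algebras and their modules

A vertex operator map `Y(·, x)` is stored through its modes: `Y(v, x) = ∑ v_n x^{-n-1}` is a linear
map `v ↦ (n ↦ v_n)`.  An identity between formal series is stated as the equality of the
coefficients of every monomial; all the sums `∑ᶠ` below have finitely many nonzero terms, by the
truncation conditions. -/

/-- The Jacobi identity
`x₀⁻¹ δ((x₁-x₂)/x₀) Y_W(u,x₁) Y_W(v,x₂) - x₀⁻¹ δ((x₂-x₁)/(-x₀)) Y_W(v,x₂) Y_W(u,x₁)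
  = x₂⁻¹ δ((x₁-x₀)/x₂) Y_W(Y(u,x₀)v,x₂)`:
the coefficients of `x₀^{-l-1} x₁^{-m-1} x₂^{-n-1}`, applied to `w`. -/
def JacobiIdentity {V W : Type*} [AddCommGroup V] [Module ℂ V] [AddCommGroup W] [Module ℂ W]
    (Y : V →ₗ[ℂ] (ℤ → Module.End ℂ V)) (YW : V →ₗ[ℂ] (ℤ → Module.End ℂ W)) : Prop :=
  ∀ (a b : V) (w : W) (l m n : ℤ),
    (∑ᶠ j : ℕ, ((-1 : ℂ) ^ j * ((Ring.choose l j : ℤ) : ℂ)) • YW a (l + m - j) (YW b (n + j) w))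
      - (∑ᶠ j : ℕ, ((-1 : ℂ) ^ (l + j) * ((Ring.choose l j : ℤ) : ℂ)) •
          YW b (l + n - j) (YW a (m + j) w))
    = ∑ᶠ i : ℕ, ((Ring.choose m i : ℤ) : ℂ) • YW (Y a (l + i) b) (m + n - i) w

/-- The Virasoro relations with central charge `c` for `L(n) = ω_{n+1}`. -/
def VirasoroRelations {V W : Type*} [AddCommGroup V] [Module ℂ V] [AddCommGroup W] [Module ℂ W]
    (YW : V →ₗ[ℂ] (ℤ → Module.End ℂ W)) (ω : V) (c : ℂ) : Prop :=
  ∀ (m n : ℤ) (w : W),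
    YW ω (m + 1) (YW ω (n + 1) w) - YW ω (n + 1) (YW ω (m + 1) w)
      = ((m : ℂ) - n) • YW ω (m + n + 1) w
        + (if m + n = 0 then (1 / 12 : ℂ) * ((m : ℂ) ^ 3 - m) * c else 0) • w

/-- A vertex operator algebra structure on the complex vector space `V`. -/
structure VertexOperatorAlgebra (V : Type u) [AddCommGroup V] [Module ℂ V] where
  /-- `Y v n = v_n` -/
  Y : V →ₗ[ℂ] (ℤ → Module.End ℂ V)
  /-- the weight spaces -/
  wt : ℤ → Submodule ℂ V
  /-- the vacuum vector -/
  vac : V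
  /-- the conformal vector -/
  ω : V
  /-- the central charge -/
  c : ℂ
  isInternal : DirectSum.IsInternal wt
  vac_mem : vac ∈ wt 0
  ω_mem : ω ∈ wt 2
  truncation : ∀ a b : V, ∃ N : ℤ, ∀ n ≥ N, Y a n b = 0
  vacuum : ∀ (n : ℤ) (b : V), Y vac n b = if n = -1 then b else 0
  creation_nonneg : ∀ (a : V) (n : ℤ), 0 ≤ n → Y a n vac = 0
  creation : ∀ a : V, Y a (-1) vac = a
  jacobi : JacobiIdentity Y Y
  virasoro : VirasoroRelations Y ω c
  /-- `d/dx Y(v,x) = Y(L(-1)v,x)`, where `L(-1) = ω_0` -/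
  derivative : ∀ (a : V) (n : ℤ), Y (Y ω 0 a) n = (-(n : ℂ)) • Y a (n - 1)
  /-- `L(0) = ω_1` acts on `V_(n)` as `n` -/
  L_zero : ∀ (n : ℤ), ∀ a ∈ wt n, Y ω 1 a = (n : ℂ) • a
  wt_lower : ∃ N : ℤ, ∀ n < N, wt n = ⊥
  wt_finite : ∀ n, Module.Finite ℂ (wt n)

/-- The data of a module: modes `v_n` acting on `W`, and a family of subspaces indexed by `ℂ`. -/
structure ModuleData (V : Type u) [AddCommGroup V] [Module ℂ V]
    (W : Type v) [AddCommGroup W] [Module ℂ W] where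
  /-- `Y v n = v_n`, acting on `W` -/
  Y : V →ₗ[ℂ] (ℤ → Module.End ℂ W)
  /-- the weight spaces -/
  wt : ℂ → Submodule ℂ W

/-- The axioms of a module for a vertex operator algebra, including the grading restrictions
`W_(n+k) = 0` for `k ∈ ℤ` sufficiently negative, and `dim W_(n) < ∞`. -/
structure IsVOAModule {V : Type u} [AddCommGroup V] [Module ℂ V] (𝒱 : VertexOperatorAlgebra V)
    {W : Type v} [AddCommGroup W] [Module ℂ W] (D : ModuleData V W) : Prop where
  isInternal : DirectSum.IsInternal D.wt
  truncation : ∀ (a : V) (w : W), ∃ N : ℤ, ∀ n ≥ N, D.Y a n w = 0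
  vacuum : ∀ (n : ℤ) (w : W), D.Y 𝒱.vac n w = if n = -1 then w else 0
  jacobi : JacobiIdentity 𝒱.Y D.Y
  virasoro : VirasoroRelations D.Y 𝒱.ω 𝒱.c
  derivative : ∀ (a : V) (n : ℤ), D.Y (𝒱.Y 𝒱.ω 0 a) n = (-(n : ℂ)) • D.Y a (n - 1)
  L_zero : ∀ (n : ℂ), ∀ w ∈ D.wt n, D.Y 𝒱.ω 1 w = n • w
  wt_lower : ∀ n : ℂ, ∃ N : ℤ, ∀ k : ℤ, k < N → D.wt (n + k) = ⊥
  wt_finite : ∀ n, Module.Finite ℂ (D.wt n)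

/-- A module for the vertex operator algebra `𝒱`, bundled with its underlying space. -/
structure VOAModule {V : Type u} [AddCommGroup V] [Module ℂ V] (𝒱 : VertexOperatorAlgebra V) where
  carrier : Type v
  [addCommGroup : AddCommGroup carrier]
  [module : Module ℂ carrier]
  data : ModuleData V carrier
  isModule : IsVOAModule 𝒱 data

attribute [instance] VOAModule.addCommGroup VOAModule.module

instance {V : Type u} [AddCommGroup V] [Module ℂ V] (𝒱 : VertexOperatorAlgebra V) :
    CoeSort (VOAModule.{u, v} 𝒱) (Type v) := ⟨VOAModule.carrier⟩

section Homomorphisms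

variable {V : Type u} [AddCommGroup V] [Module ℂ V]
  {W W' : Type*} [AddCommGroup W] [Module ℂ W] [AddCommGroup W'] [Module ℂ W']

/-- Module maps: linear maps commuting with all `v_n` and preserving the grading. -/
structure ModuleHom (D : ModuleData V W) (D' : ModuleData V W') extends W →ₗ[ℂ] W' where
  map_Y : ∀ (a : V) (n : ℤ) (w : W), toLinearMap (D.Y a n w) = D'.Y a n (toLinearMap w)
  map_wt : ∀ (n : ℂ), ∀ w ∈ D.wt n, toLinearMap w ∈ D'.wt n

/-- Equivalence of modules: a bijective module map whose inverse is a module map too. -/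
def ModuleIso (D : ModuleData V W) (D' : ModuleData V W') : Prop :=
  ∃ (f : ModuleHom D D') (g : ModuleHom D' D),
    (∀ w, g.toLinearMap (f.toLinearMap w) = w) ∧ (∀ w, f.toLinearMap (g.toLinearMap w) = w)

/-- The formal completion `W̄ = ∏_n W_(n)`.  For `x : W̄`, the projection `π_n x` is `x n`. -/
def Completion (D : ModuleData V W) : Type _ := ∀ n : ℂ, D.wt n

instance (D : ModuleData V W) : AddCommGroup (Completion D) :=
  inferInstanceAs (AddCommGroup (∀ n : ℂ, D.wt n))

instance (D : ModuleData V W) : Module ℂ (Completion D) :=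
  inferInstanceAs (Module ℂ (∀ n : ℂ, D.wt n))

/-- The projection `π_n : W̄ → W_(n)`. -/
def Completion.proj (D : ModuleData V W) (n : ℂ) : Completion D →ₗ[ℂ] D.wt n where
  toFun x := x n
  map_add' _ _ := rfl
  map_smul' _ _ := rfl

/-- A linear map into the completion, from its components. -/
def Completion.lift {X : Type*} [AddCommGroup X] [Module ℂ X] (D : ModuleData V W)
    (f : ∀ n : ℂ, X →ₗ[ℂ] D.wt n) : X →ₗ[ℂ] Completion D where
  toFun x n := f n x
  map_add' x y := funext fun n => map_add (f n) x y
  map_smul' t x := funext fun n => map_smul (f n) t x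

@[simp]
theorem Completion.zero_apply {D : ModuleData V W} (n : ℂ) : (0 : Completion D) n = 0 := rfl

@[simp]
theorem Completion.add_apply {D : ModuleData V W} (x y : Completion D) (n : ℂ) :
    (x + y) n = x n + y n := rfl

@[simp]
theorem Completion.smul_apply {D : ModuleData V W} (t : ℂ) (x : Completion D) (n : ℂ) :
    (t • x) n = t • x n := rfl

/-- The extension `η̄ : W̄ → W̄'` of a module map `η`. -/
def ModuleHom.completionMap {D : ModuleData V W} {D' : ModuleData V W'} (η : ModuleHom D D') :
    Completion D →ₗ[ℂ] Completion D' :=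
  Completion.lift D' fun n => (η.toLinearMap.restrict (η.map_wt n)) ∘ₗ Completion.proj D n

/-- Submodules: subspaces stable under all `v_n`.  (For a module such a subspace is stable under
`L(0) = ω_1`, which acts on `W_(n)` as the scalar `n`, so that it is automatically graded.) -/
def IsStable (D : ModuleData V W) (N : Submodule ℂ W) : Prop :=
  ∀ (a : V) (n : ℤ), ∀ w ∈ N, D.Y a n w ∈ N

/-- Irreducible submodules: nonzero submodules without proper nonzero submodules. -/
def IsIrreducibleSubmodule (D : ModuleData V W) (N : Submodule ℂ W) : Prop :=
  IsStable D N ∧ N ≠ ⊥ ∧ ∀ N' ≤ N, IsStable D N' → N' = ⊥ ∨ N' = N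

/-- Irreducible modules. -/
def IsIrreducibleModule (D : ModuleData V W) : Prop :=
  IsIrreducibleSubmodule D ⊤

/-- Completely reducible modules: direct sums of irreducible submodules. -/
def IsCompletelyReducible (D : ModuleData V W) : Prop :=
  ∃ S : Set (Submodule ℂ W), (∀ N ∈ S, IsIrreducibleSubmodule D N) ∧
    iSupIndep (fun N : S => (N : Submodule ℂ W)) ∧ sSup S = ⊤

end Homomorphisms

theorem finite_support_of_eventually_zero {E : Type*} [Zero E] {f : ℕ → E}
    (h : ∃ N : ℕ, ∀ j ≥ N, f j = 0) : f.support.Finite := by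
  obtain ⟨N, hN⟩ := h
  refine (Set.finite_lt_nat N).subset fun j hj => ?_
  by_contra hlt
  exact hj (hN j (not_lt.mp hlt))

theorem exists_nat_truncation {E : Type*} [Zero E] {f : ℤ → E} (h : ∃ N : ℤ, ∀ n ≥ N, f n = 0)
    (l : ℤ) : ∃ N : ℕ, ∀ j : ℕ, j ≥ N → f (l + j) = 0 := by
  obtain ⟨N, hN⟩ := h
  exact ⟨(N - l).toNat, fun j hj => hN _ (by omega)⟩

section Intertwining

variable {V : Type u} [AddCommGroup V] [Module ℂ V] {𝒱 : VertexOperatorAlgebra V}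

/-! ## Logarithmic intertwining operators and fusion rules -/

/-- Logarithmic intertwining operators of type `(W₃ over W₁ W₂)`.  The value
`𝒴 (w₁ ⊗ w₂) n k` is the coefficient `(w₁)_{n;k} w₂` in
`𝒴(w₁,x)w₂ = ∑_{n ∈ ℂ} ∑_{k ∈ ℕ} (w₁)_{n;k} w₂ x^{-n-1} (log x)^k`; for every power of `x` this is
a polynomial in `log x`.  The `𝔰𝔩(2)`-bracket relations are written with `s = j + 1 ∈ {0,1,2}`,
so that `L(j) = ω_s`. -/
structure IsLogIntertwiningOperator (W₁ W₂ W₃ : VOAModule.{u, v} 𝒱)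
    (𝒴 : W₁ ⊗[ℂ] W₂ →ₗ[ℂ] (ℂ → ℕ →₀ W₃)) : Prop where
  truncation : ∀ (w₁ : W₁) (w₂ : W₂) (n : ℂ), ∃ N : ℕ, ∀ m : ℕ, m ≥ N → 𝒴 (w₁ ⊗ₜ w₂) (n + m) = 0
  /-- the coefficient of `x₀^{-l-1} x₁^{-m-1} x₂^{-n-1} (log x₂)^k` in the Jacobi identity -/
  jacobi : ∀ (a : V) (w₁ : W₁) (w₂ : W₂) (l m : ℤ) (n : ℂ) (k : ℕ),
    (∑ᶠ j : ℕ, ((-1 : ℂ) ^ j * ((Ring.choose l j : ℤ) : ℂ)) •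
        W₃.data.Y a (l + m - j) (𝒴 (w₁ ⊗ₜ w₂) (n + j) k))
      - (∑ᶠ j : ℕ, ((-1 : ℂ) ^ (l + j) * ((Ring.choose l j : ℤ) : ℂ)) •
          𝒴 (w₁ ⊗ₜ W₂.data.Y a (m + j) w₂) (l + n - j) k)
    = ∑ᶠ i : ℕ, ((Ring.choose m i : ℤ) : ℂ) • 𝒴 (W₁.data.Y a (l + i) w₁ ⊗ₜ w₂) (m + n - i) k
  /-- `𝒴(L(-1)w₁,x) = d/dx 𝒴(w₁,x)` -/
  derivative : ∀ (w₁ : W₁) (w₂ : W₂) (n : ℂ) (k : ℕ),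
    𝒴 (W₁.data.Y 𝒱.ω 0 w₁ ⊗ₜ w₂) n k
      = (-n) • 𝒴 (w₁ ⊗ₜ w₂) (n - 1) k + ((k : ℂ) + 1) • 𝒴 (w₁ ⊗ₜ w₂) (n - 1) (k + 1)
  bracket : ∀ (w₁ : W₁) (w₂ : W₂) (s : ℕ), s ≤ 2 → ∀ (n : ℂ) (k : ℕ),
    W₃.data.Y 𝒱.ω s (𝒴 (w₁ ⊗ₜ w₂) n k) - 𝒴 (w₁ ⊗ₜ W₂.data.Y 𝒱.ω s w₂) n k
      = ∑ i ∈ Finset.range (s + 1),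
          (s.choose i : ℂ) • 𝒴 (W₁.data.Y 𝒱.ω (s - i) w₁ ⊗ₜ w₂) (n + i) k

/-- The space `𝒱_{W₁W₂}^{W₃}` of logarithmic intertwining operators. -/
def logIntertwiningOperators (W₁ W₂ W₃ : VOAModule.{u, v} 𝒱) :
    Submodule ℂ (W₁ ⊗[ℂ] W₂ →ₗ[ℂ] (ℂ → ℕ →₀ W₃)) where
  carrier := {𝒴 | IsLogIntertwiningOperator W₁ W₂ W₃ 𝒴}
  zero_mem' := by
    constructor <;> intros <;> simp
  add_mem' := by
    intro 𝒴 𝒵 h𝒴 h𝒵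
    have fin₁ : ∀ {𝒳 : W₁ ⊗[ℂ] W₂ →ₗ[ℂ] (ℂ → ℕ →₀ W₃)}, IsLogIntertwiningOperator W₁ W₂ W₃ 𝒳 →
        ∀ (a : V) (w₁ : W₁) (w₂ : W₂) (l m : ℤ) (n : ℂ) (k : ℕ),
        (Function.support fun j : ℕ => ((-1 : ℂ) ^ j * ((Ring.choose l j : ℤ) : ℂ)) •
          W₃.data.Y a (l + m - j) (𝒳 (w₁ ⊗ₜ w₂) (n + j) k)).Finite := by
      intro 𝒳 h𝒳 a w₁ w₂ l m n k
      obtain ⟨N, hN⟩ := h𝒳.truncation w₁ w₂ n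
      exact finite_support_of_eventually_zero ⟨N, fun j hj => by simp [hN j hj]⟩
    have fin₂ : ∀ (𝒳 : W₁ ⊗[ℂ] W₂ →ₗ[ℂ] (ℂ → ℕ →₀ W₃))
        (a : V) (w₁ : W₁) (w₂ : W₂) (l m : ℤ) (n : ℂ) (k : ℕ),
        (Function.support fun j : ℕ => ((-1 : ℂ) ^ (l + j) * ((Ring.choose l j : ℤ) : ℂ)) •
          𝒳 (w₁ ⊗ₜ W₂.data.Y a (m + j) w₂) (l + n - j) k).Finite := by
      intro 𝒳 a w₁ w₂ l m n k
      obtain ⟨N, hN⟩ := exists_nat_truncation (W₂.isModule.truncation a w₂) m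
      exact finite_support_of_eventually_zero ⟨N, fun j hj => by simp [hN j hj]⟩
    have fin₃ : ∀ (𝒳 : W₁ ⊗[ℂ] W₂ →ₗ[ℂ] (ℂ → ℕ →₀ W₃))
        (a : V) (w₁ : W₁) (w₂ : W₂) (l m : ℤ) (n : ℂ) (k : ℕ),
        (Function.support fun i : ℕ => ((Ring.choose m i : ℤ) : ℂ) •
          𝒳 (W₁.data.Y a (l + i) w₁ ⊗ₜ w₂) (m + n - i) k).Finite := by
      intro 𝒳 a w₁ w₂ l m n k
      obtain ⟨N, hN⟩ := exists_nat_truncation (W₁.isModule.truncation a w₁) l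
      exact finite_support_of_eventually_zero ⟨N, fun j hj => by simp [hN j hj]⟩
    constructor
    · intro w₁ w₂ n
      obtain ⟨N, hN⟩ := h𝒴.truncation w₁ w₂ n
      obtain ⟨M, hM⟩ := h𝒵.truncation w₁ w₂ n
      refine ⟨max N M, fun m hm => ?_⟩
      simp [hN m (le_of_max_le_left hm), hM m (le_of_max_le_right hm)]
    · intro a w₁ w₂ l m n k
      have e := congrArg₂ (· + ·) (h𝒴.jacobi a w₁ w₂ l m n k) (h𝒵.jacobi a w₁ w₂ l m n k)
      simp only [LinearMap.add_apply, Pi.add_apply, Finsupp.add_apply, map_add, smul_add]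
      rw [finsum_add_distrib (fin₁ h𝒴 ..) (fin₁ h𝒵 ..), finsum_add_distrib (fin₂ ..) (fin₂ ..),
        finsum_add_distrib (fin₃ ..) (fin₃ ..), ← e]
      abel
    · intro w₁ w₂ n k
      simp only [LinearMap.add_apply, Pi.add_apply, Finsupp.add_apply, h𝒴.derivative,
        h𝒵.derivative, smul_add]
      abel
    · intro w₁ w₂ s hs n k
      have e := congrArg₂ (· + ·) (h𝒴.bracket w₁ w₂ s hs n k) (h𝒵.bracket w₁ w₂ s hs n k)
      simp only [LinearMap.add_apply, Pi.add_apply, Finsupp.add_apply, map_add, smul_add,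
        Finset.sum_add_distrib]
      rw [← e]
      abel
  smul_mem' := by
    intro t 𝒴 h𝒴
    constructor
    · intro w₁ w₂ n
      obtain ⟨N, hN⟩ := h𝒴.truncation w₁ w₂ n
      exact ⟨N, fun m hm => by simp [hN m hm]⟩
    · intro a w₁ w₂ l m n k
      have e := congrArg (t • ·) (h𝒴.jacobi a w₁ w₂ l m n k)
      simp only [smul_sub, smul_finsum] at e
      simpa only [LinearMap.smul_apply, Pi.smul_apply, Finsupp.smul_apply, map_smul,
        smul_comm _ t] using e
    · intro w₁ w₂ n k
      simp only [LinearMap.smul_apply, Pi.smul_apply, Finsupp.smul_apply, h𝒴.derivative,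
        smul_add, smul_comm _ t]
    · intro w₁ w₂ s hs n k
      have e := congrArg (t • ·) (h𝒴.bracket w₁ w₂ s hs n k)
      simp only [smul_sub, Finset.smul_sum] at e
      simpa only [LinearMap.smul_apply, Pi.smul_apply, Finsupp.smul_apply, map_smul,
        smul_comm _ t] using e

/-- `M₁, …, M_k` is a set of representatives of the equivalence classes of irreducible modules. -/
structure IsIrreducibleSystem {k : ℕ} (M : Fin k → VOAModule.{u, v} 𝒱) : Prop where
  irreducible : ∀ i, IsIrreducibleModule (M i).data
  distinct : ∀ i j, ModuleIso (M i).data (M j).data → i = j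
  complete : ∀ W : VOAModule.{u, v} 𝒱, IsIrreducibleModule W.data →
    ∃ i, ModuleIso W.data (M i).data

variable (𝒱) in
/-- Finitely reductive vertex operator algebras: every module is completely reducible, there are
finitely many irreducible modules up to equivalence, and all the fusion rules are finite. -/
structure FinitelyReductive : Prop where
  completelyReducible : ∀ W : VOAModule.{u, v} 𝒱, IsCompletelyReducible W.data
  finite_irreducible : ∃ (k : ℕ) (M : Fin k → VOAModule.{u, v} 𝒱), IsIrreducibleSystem M
  finite_fusion : ∀ W₁ W₂ W₃ : VOAModule.{u, v} 𝒱,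
    Module.Finite ℂ (logIntertwiningOperators W₁ W₂ W₃)

/-! ## `P(z)`-intertwining maps and `P(z)`-tensor products -/

variable (𝒱) in
/-- The decomposition of the elements of `V` into homogeneous components. -/
def VertexOperatorAlgebra.decomp : V ≃ₗ[ℂ] ⨁ n, 𝒱.wt n :=
  (LinearEquiv.ofBijective (DirectSum.coeLinearMap 𝒱.wt) 𝒱.isInternal).symm

open Classical in
/-- The weight `p` component of `v_n x`, for `v ∈ V` and `x` in the completion of a module `W`.
If `v` is homogeneous of weight `k`, then `v_n` maps `W_(q)` into `W_(q+k-n-1)`, so this is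
`v_n x_q` for `q = p-k+n+1`; in general it is the sum over the homogeneous components of `v`. -/
def completionAct {W : VOAModule.{u, v} 𝒱} (a : V) (n : ℤ) (x : Completion W.data) (p : ℂ) : W :=
  ∑ k ∈ (𝒱.decomp a).support, W.data.Y (𝒱.decomp a k : V) n (x (p - k + n + 1) : W)

/-- `P(z)`-intertwining maps of type `(W₃ over W₁ W₂)`.  In the `𝔰𝔩(2)`-bracket relations
`s = j + 1 ∈ {0,1,2}`, so that `L(j) = ω_s`. -/
structure IsPzIntertwiningMap (z : ℂ) (W₁ W₂ W₃ : VOAModule.{u, v} 𝒱)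
    (I : W₁ ⊗[ℂ] W₂ →ₗ[ℂ] Completion W₃.data) : Prop where
  truncation : ∀ (w₁ : W₁) (w₂ : W₂) (n : ℂ), ∃ N : ℕ, ∀ m : ℕ, m ≥ N → I (w₁ ⊗ₜ w₂) (n - m) = 0
  /-- the weight `p` component of the coefficient of `x₀^{-l-1} x₁^{-m-1}` in the Jacobi identity
  `x₀⁻¹ δ((x₁-z)/x₀) Y₃(v,x₁) I(w₁ ⊗ w₂)
    = z⁻¹ δ((x₁-x₀)/z) I(Y₁(v,x₀)w₁ ⊗ w₂) + x₀⁻¹ δ((z-x₁)/(-x₀)) I(w₁ ⊗ Y₂(v,x₁)w₂)` -/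
  jacobi : ∀ (a : V) (w₁ : W₁) (w₂ : W₂) (l m : ℤ) (p : ℂ),
    (∑ᶠ j : ℕ, ((-z) ^ j * ((Ring.choose l j : ℤ) : ℂ)) •
        completionAct a (l + m - j) (I (w₁ ⊗ₜ w₂)) p)
    = (∑ᶠ i : ℕ, (z ^ (m - i) * ((Ring.choose m i : ℤ) : ℂ)) •
        (I (W₁.data.Y a (l + i) w₁ ⊗ₜ w₂) p : W₃))
      + ∑ᶠ j : ℕ, ((-1 : ℂ) ^ (l + j) * z ^ (l - j) * ((Ring.choose l j : ℤ) : ℂ)) •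
        (I (w₁ ⊗ₜ W₂.data.Y a (m + j) w₂) p : W₃)
  bracket : ∀ (w₁ : W₁) (w₂ : W₂) (s : ℕ), s ≤ 2 → ∀ p : ℂ,
    completionAct 𝒱.ω s (I (w₁ ⊗ₜ w₂)) p
      = (I (w₁ ⊗ₜ W₂.data.Y 𝒱.ω s w₂) p : W₃)
        + ∑ i ∈ Finset.range (s + 1), ((s.choose i : ℂ) * z ^ i) •
          (I (W₁.data.Y 𝒱.ω (s - i) w₁ ⊗ₜ w₂) p : W₃)

theorem completionAct_add {W : VOAModule.{u, v} 𝒱} (a : V) (n : ℤ) (x y : Completion W.data)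
    (p : ℂ) : completionAct a n (x + y) p = completionAct a n x p + completionAct a n y p := by
  simp [completionAct, Finset.sum_add_distrib]

theorem completionAct_smul {W : VOAModule.{u, v} 𝒱} (a : V) (n : ℤ) (t : ℂ)
    (x : Completion W.data) (p : ℂ) :
    completionAct a n (t • x) p = t • completionAct a n x p := by
  simp [completionAct, Finset.smul_sum]

theorem completionAct_truncation {W : VOAModule.{u, v} 𝒱} (a : V) (l : ℤ) (x : Completion W.data)
    (p : ℂ) (hx : ∀ n : ℂ, ∃ N : ℕ, ∀ m : ℕ, m ≥ N → x (n - m) = 0) :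
    ∃ N : ℕ, ∀ j : ℕ, j ≥ N → completionAct a (l - j) x p = 0 := by
  classical
  choose N hN using hx
  refine ⟨(𝒱.decomp a).support.sup fun k => N (p - k + l + 1), fun j hj => ?_⟩
  refine Finset.sum_eq_zero fun k hk => ?_
  have e : p - (k : ℂ) + ((l - j : ℤ) : ℂ) + 1 = (p - k + l + 1) - (j : ℂ) := by
    push_cast; ring
  rw [e, hN _ j ((Finset.le_sup (f := fun k : ℤ => N (p - k + l + 1)) hk).trans hj)]
  simp

/-- The space `ℳ[P(z)]_{W₁W₂}^{W₃}` of `P(z)`-intertwining maps. -/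
def pzIntertwiningMaps (z : ℂ) (W₁ W₂ W₃ : VOAModule.{u, v} 𝒱) :
    Submodule ℂ (W₁ ⊗[ℂ] W₂ →ₗ[ℂ] Completion W₃.data) where
  carrier := {I | IsPzIntertwiningMap z W₁ W₂ W₃ I}
  zero_mem' := by
    constructor <;> intros <;> simp [completionAct]
  add_mem' := by
    intro I J hI hJ
    have fin₁ : ∀ {K : W₁ ⊗[ℂ] W₂ →ₗ[ℂ] Completion W₃.data}, IsPzIntertwiningMap z W₁ W₂ W₃ K →
        ∀ (a : V) (w₁ : W₁) (w₂ : W₂) (l m : ℤ) (p : ℂ),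
        (Function.support fun j : ℕ => ((-z) ^ j * ((Ring.choose l j : ℤ) : ℂ)) •
          completionAct a (l + m - j) (K (w₁ ⊗ₜ w₂)) p).Finite := by
      intro K hK a w₁ w₂ l m p
      obtain ⟨N, hN⟩ := completionAct_truncation a (l + m) _ p (hK.truncation w₁ w₂)
      exact finite_support_of_eventually_zero ⟨N, fun j hj => by simp [hN j hj]⟩
    have fin₂ : ∀ (K : W₁ ⊗[ℂ] W₂ →ₗ[ℂ] Completion W₃.data)
        (a : V) (w₁ : W₁) (w₂ : W₂) (l m : ℤ) (p : ℂ),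
        (Function.support fun i : ℕ => (z ^ (m - i) * ((Ring.choose m i : ℤ) : ℂ)) •
          (K (W₁.data.Y a (l + i) w₁ ⊗ₜ w₂) p : W₃)).Finite := by
      intro K a w₁ w₂ l m p
      obtain ⟨N, hN⟩ := exists_nat_truncation (W₁.isModule.truncation a w₁) l
      exact finite_support_of_eventually_zero ⟨N, fun j hj => by simp [hN j hj]⟩
    have fin₃ : ∀ (K : W₁ ⊗[ℂ] W₂ →ₗ[ℂ] Completion W₃.data)
        (a : V) (w₁ : W₁) (w₂ : W₂) (l m : ℤ) (p : ℂ),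
        (Function.support fun j : ℕ =>
          ((-1 : ℂ) ^ (l + j) * z ^ (l - j) * ((Ring.choose l j : ℤ) : ℂ)) •
          (K (w₁ ⊗ₜ W₂.data.Y a (m + j) w₂) p : W₃)).Finite := by
      intro K a w₁ w₂ l m p
      obtain ⟨N, hN⟩ := exists_nat_truncation (W₂.isModule.truncation a w₂) m
      exact finite_support_of_eventually_zero ⟨N, fun j hj => by simp [hN j hj]⟩
    constructor
    · intro w₁ w₂ n
      obtain ⟨N, hN⟩ := hI.truncation w₁ w₂ n
      obtain ⟨M, hM⟩ := hJ.truncation w₁ w₂ n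
      refine ⟨max N M, fun m hm => ?_⟩
      simp [hN m (le_of_max_le_left hm), hM m (le_of_max_le_right hm)]
    · intro a w₁ w₂ l m p
      have e := congrArg₂ (· + ·) (hI.jacobi a w₁ w₂ l m p) (hJ.jacobi a w₁ w₂ l m p)
      simp only [LinearMap.add_apply, Completion.add_apply, Submodule.coe_add, completionAct_add, smul_add]
      rw [finsum_add_distrib (fin₁ hI ..) (fin₁ hJ ..), finsum_add_distrib (fin₂ ..) (fin₂ ..),
        finsum_add_distrib (fin₃ ..) (fin₃ ..)]
      refine e.trans ?_
      abel
    · intro w₁ w₂ s hs p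
      have e := congrArg₂ (· + ·) (hI.bracket w₁ w₂ s hs p) (hJ.bracket w₁ w₂ s hs p)
      simp only [LinearMap.add_apply, Completion.add_apply, Submodule.coe_add, completionAct_add, smul_add,
        Finset.sum_add_distrib]
      refine e.trans ?_
      abel
  smul_mem' := by
    intro t I hI
    constructor
    · intro w₁ w₂ n
      obtain ⟨N, hN⟩ := hI.truncation w₁ w₂ n
      exact ⟨N, fun m hm => by simp [hN m hm]⟩
    · intro a w₁ w₂ l m p
      have e := congrArg (t • ·) (hI.jacobi a w₁ w₂ l m p)
      simp only [smul_add, smul_finsum] at e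
      simpa only [LinearMap.smul_apply, Completion.smul_apply, Submodule.coe_smul, completionAct_smul,
        smul_comm _ t] using e
    · intro w₁ w₂ s hs p
      have e := congrArg (t • ·) (hI.bracket w₁ w₂ s hs p)
      simp only [smul_add, Finset.smul_sum] at e
      simpa only [LinearMap.smul_apply, Completion.smul_apply, Submodule.coe_smul, completionAct_smul,
        smul_comm _ t] using e

/-- `(T; I)` is a `P(z)`-tensor product of `W₁` and `W₂` in the category of `V`-modules: it is a
`P(z)`-product, and for every `P(z)`-product `(W; J)` there is a unique module map `η : T → W`
with `J = η̄ ∘ I`. -/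
structure IsPzTensorProduct (z : ℂ) (W₁ W₂ T : VOAModule.{u, v} 𝒱)
    (I : W₁ ⊗[ℂ] W₂ →ₗ[ℂ] Completion T.data) : Prop where
  mem : I ∈ pzIntertwiningMaps z W₁ W₂ T
  universal : ∀ W : VOAModule.{u, v} 𝒱, ∀ J ∈ pzIntertwiningMaps z W₁ W₂ W,
    ∃! η : ModuleHom T.data W.data, J = η.completionMap ∘ₗ I

end Intertwining

/-! ## The module `∐ᵢ (ℳ_{W₁W₂}^{Mᵢ})* ⊗ Mᵢ` -/

section Construction

variable {V : Type u} [AddCommGroup V] [Module ℂ V]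

/-- The structure on `U ⊗ W` given by `v_n (f ⊗ w) = f ⊗ v_n w` and
`(U ⊗ W)_(n) = U ⊗ W_(n)`. -/
def ModuleData.tensorLeft {W : Type*} [AddCommGroup W] [Module ℂ W] (U : Type*) [AddCommGroup U]
    [Module ℂ U] (D : ModuleData V W) : ModuleData V (U ⊗[ℂ] W) where
  Y := LinearMap.pi fun n => (LinearMap.lTensorHom U) ∘ₗ (LinearMap.proj n) ∘ₗ D.Y
  wt n := LinearMap.range (LinearMap.lTensor U (D.wt n).subtype)

/-- The direct sum structure, with componentwise action and grading. -/
def ModuleData.directSum {ι : Type*} {W : ι → Type*} [∀ i, AddCommGroup (W i)]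
    [∀ i, Module ℂ (W i)] (D : ∀ i, ModuleData V (W i)) : ModuleData V (⨁ i, W i) where
  Y :=
    { toFun := fun a n => DirectSum.lmap fun i => (D i).Y a n
      map_add' := fun a b => by ext; simp
      map_smul' := fun t a => by ext; simp [DirectSum.smul_apply] }
  wt n := ⨅ i, ((D i).wt n).comap (DirectSum.component ℂ ι W i)

/-- The canonical inclusions into a direct sum. -/
def ModuleHom.inclusion {ι : Type*} [DecidableEq ι] {W : ι → Type*} [∀ i, AddCommGroup (W i)]
    [∀ i, Module ℂ (W i)] (D : ∀ i, ModuleData V (W i)) (i : ι) :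
    ModuleHom (D i) (ModuleData.directSum D) where
  toLinearMap := DirectSum.lof ℂ ι W i
  map_Y a n w := (DirectSum.lmap_lof (fun i => (D i).Y a n) i w).symm
  map_wt n w hw := by
    rw [ModuleData.directSum, Submodule.mem_iInf]
    intro j
    by_cases h : i = j
    · subst h
      simpa using hw
    · simp [DirectSum.component.of, h]

variable {𝒱 : VertexOperatorAlgebra V}

/-- The map `ℱ[P(z)]_{W₁W₂}^{W₃} : W₁ ⊗ W₂ → Hom(ℳ, W̄₃) = ℳ* ⊗ W̄₃`, the completion of `ℳ* ⊗ W₃`,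
where `ℳ = ℳ_{W₁W₂}^{W₃}` is finite-dimensional: its weight `n` component at `t` is the element of
`ℳ* ⊗ (W₃)_(n)` that corresponds to the linear map `I ↦ π_n I(t)` from `ℳ` to `(W₃)_(n)`. -/
def pzEvaluation (z : ℂ) (W₁ W₂ W₃ : VOAModule.{u, v} 𝒱)
    [Module.Finite ℂ (pzIntertwiningMaps z W₁ W₂ W₃)] :
    W₁ ⊗[ℂ] W₂ →ₗ[ℂ] Completion
      (W₃.data.tensorLeft (Module.Dual ℂ (pzIntertwiningMaps z W₁ W₂ W₃))) :=
  Completion.lift _ fun n =>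
    (LinearMap.lTensor (Module.Dual ℂ (pzIntertwiningMaps z W₁ W₂ W₃))
        (W₃.data.wt n).subtype).rangeRestrict
      ∘ₗ (dualTensorHomEquiv ℂ (pzIntertwiningMaps z W₁ W₂ W₃) (W₃.data.wt n)).symm.toLinearMap
      ∘ₗ LinearMap.compRight ℂ (Completion.proj W₃.data n)
      ∘ₗ (pzIntertwiningMaps z W₁ W₂ W₃).subtype.flip

/-- The structure on `∐ᵢ (ℳ_{W₁W₂}^{Mᵢ})* ⊗ Mᵢ`. -/
def pzTensorData (z : ℂ) (W₁ W₂ : VOAModule.{u, v} 𝒱) {k : ℕ} (M : Fin k → VOAModule.{u, v} 𝒱) :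
    ModuleData V (⨁ i, Module.Dual ℂ (pzIntertwiningMaps z W₁ W₂ (M i)) ⊗[ℂ] (M i)) :=
  ModuleData.directSum fun i =>
    (M i).data.tensorLeft (Module.Dual ℂ (pzIntertwiningMaps z W₁ W₂ (M i)))

/-- The map `∑ᵢ ℱ[P(z)]_{W₁W₂}^{Mᵢ}` into the completion of `∐ᵢ (ℳ_{W₁W₂}^{Mᵢ})* ⊗ Mᵢ`. -/
def pzTensorMap (z : ℂ) (W₁ W₂ : VOAModule.{u, v} 𝒱) {k : ℕ} (M : Fin k → VOAModule.{u, v} 𝒱)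
    [∀ i, Module.Finite ℂ (pzIntertwiningMaps z W₁ W₂ (M i))] :
    W₁ ⊗[ℂ] W₂ →ₗ[ℂ] Completion (pzTensorData z W₁ W₂ M) :=
  ∑ i, (ModuleHom.inclusion (fun i => (M i).data.tensorLeft
      (Module.Dual ℂ (pzIntertwiningMaps z W₁ W₂ (M i)))) i).completionMap
    ∘ₗ pzEvaluation z W₁ W₂ (M i)

/-- The module `∐ᵢ (ℳ_{W₁W₂}^{Mᵢ})* ⊗ Mᵢ`, given that its structure satisfies the axioms. -/
def pzTensorModule (z : ℂ) (W₁ W₂ : VOAModule.{u, v} 𝒱) {k : ℕ} (M : Fin k → VOAModule.{u, v} 𝒱)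
    (hM : IsVOAModule 𝒱 (pzTensorData z W₁ W₂ M)) : VOAModule.{u, v} 𝒱 where
  carrier := ⨁ i, Module.Dual ℂ (pzIntertwiningMaps z W₁ W₂ (M i)) ⊗[ℂ] (M i)
  data := pzTensorData z W₁ W₂ M
  isModule := hM

end Construction

end

/-! The universal property only has to be tested on irreducible targets: every module is a finite
direct sum of the `M i`, and a `P(z)`-intertwining map into a direct sum is the family of its
projections. Write `ℳᵢ` for the space of intertwining maps into `M i`, and `T` for `∐ᵢ ℳᵢ* ⊗ Mᵢ`. By
Schur's lemma a module map `T → Mᵢ` vanishes on the summands `j ≠ i` and is `f ⊗ w ↦ θ(f) w` on the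
`i`-th, with `θ ∈ ℳᵢ**`. When `ℳᵢ` is finite-dimensional, `θ` is evaluation at a unique `K ∈ ℳᵢ`
(`exists_eq_pzContract`), and composing this map with the canonical map gives back `K`
(`pzContract_comp_pzTensorMap`). So `Hom(T, Mᵢ) = ℳᵢ`, which is the universal property for `Mᵢ`;
`existsUnique_pzTensorMap` assembles the general case.

Finite-dimensionality of `ℳᵢ` comes from the fusion rules. An intertwining map `I` is an
intertwining operator evaluated at `x = z`; since `L(0)` is semisimple on modules, the operator is
recovered, without logarithms, by weighting the homogeneous components of `I` with powers of `z`.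
This embeds `ℳᵢ` into the logarithmic intertwining operators
(`intertwiningOperatorEmbedding_injective`).

That `T` is a module follows from `IsVOAModule.of_retract`: bases of the `ℳᵢ*` exhibit `T` as a
finite sum of copies of the `Mᵢ`. Gradings cost little throughout, because weight spaces are exactly
the eigenspaces of `L(0)` (`IsVOAModule.mem_wt_iff`). -/

noncomputable section

/-! ### Module maps and their extension to completions -/

section Homomorphisms

variable {V : Type u} [AddCommGroup V] [Module ℂ V]
  {W W' W'' : Type*} [AddCommGroup W] [Module ℂ W] [AddCommGroup W'] [Module ℂ W']
  [AddCommGroup W''] [Module ℂ W'']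
  {D : ModuleData V W} {D' : ModuleData V W'} {D'' : ModuleData V W''}

theorem Completion.ext' {x y : Completion D} (h : ∀ n, (x n : W) = y n) : x = y :=
  funext fun n => Subtype.ext (h n)

theorem Completion.coe_linearMap_sum_apply {X ι : Type*} [AddCommGroup X] [Module ℂ X]
    (s : Finset ι) (f : ι → X →ₗ[ℂ] Completion D) (x : X) (n : ℂ) :
    ((∑ i ∈ s, f i) x n : W) = ∑ i ∈ s, (f i x n : W) :=
  map_sum ((D.wt n).subtype ∘ₗ Completion.proj D n ∘ₗ LinearMap.applyₗ x) f s

namespace ModuleHom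

theorem ext' {η θ : ModuleHom D D'} (h : ∀ w, η.toLinearMap w = θ.toLinearMap w) : η = θ := by
  cases η; cases θ
  congr
  exact LinearMap.ext h

theorem completionMap_apply (η : ModuleHom D D') (x : Completion D) (n : ℂ) :
    (η.completionMap x n : W') = η.toLinearMap (x n) := rfl

/-- The composite of two module maps. -/
def comp (η : ModuleHom D' D'') (θ : ModuleHom D D') : ModuleHom D D'' where
  toLinearMap := η.toLinearMap ∘ₗ θ.toLinearMap
  map_Y a n w := by simp [θ.map_Y, η.map_Y]
  map_wt n w hw := η.map_wt n _ (θ.map_wt n w hw)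

@[simp]
theorem comp_apply (η : ModuleHom D' D'') (θ : ModuleHom D D') (w : W) :
    (η.comp θ).toLinearMap w = η.toLinearMap (θ.toLinearMap w) := rfl

theorem completionMap_comp (η : ModuleHom D' D'') (θ : ModuleHom D D') :
    (η.comp θ).completionMap = η.completionMap ∘ₗ θ.completionMap := rfl

/-- A finite sum of module maps. -/
def sum {ι : Type*} [Fintype ι] (η : ι → ModuleHom D D') : ModuleHom D D' where
  toLinearMap := ∑ i, (η i).toLinearMap
  map_Y a n w := by simp [map_Y]
  map_wt n w hw := by
    rw [LinearMap.sum_apply]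
    exact Submodule.sum_mem _ fun i _ => (η i).map_wt n w hw

@[simp]
theorem sum_apply {ι : Type*} [Fintype ι] (η : ι → ModuleHom D D') (w : W) :
    (sum η).toLinearMap w = ∑ i, (η i).toLinearMap w :=
  LinearMap.sum_apply ..

theorem ker_isStable (η : ModuleHom D D') : IsStable D (LinearMap.ker η.toLinearMap) := by
  intro a n w hw
  rw [LinearMap.mem_ker] at hw ⊢
  rw [η.map_Y, hw, map_zero]

theorem range_isStable (η : ModuleHom D D') : IsStable D' (LinearMap.range η.toLinearMap) := by
  rintro a n _ ⟨w, rfl⟩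
  exact ⟨D.Y a n w, η.map_Y a n w⟩

end ModuleHom

end Homomorphisms

/-! ### Weight spaces as eigenspaces of `L(0)` -/

section Weights

variable {V : Type u} [AddCommGroup V] [Module ℂ V] {𝒱 : VertexOperatorAlgebra V}
  {W W' : Type*} [AddCommGroup W] [Module ℂ W] [AddCommGroup W'] [Module ℂ W']
  {D : ModuleData V W} {D' : ModuleData V W'}

/-- No zero case is needed: the index type is nonempty and `0` lies in every `p i`. -/
theorem iSup_wt_induction {R E ι : Type*} [Semiring R] [AddCommMonoid E] [Module R E] [Nonempty ι]
    {p : ι → Submodule R E} (hp : iSup p = ⊤) {P : E → Prop} (mem : ∀ i, ∀ x ∈ p i, P x)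
    (add : ∀ x y, P x → P y → P (x + y)) (x : E) : P x :=
  Submodule.iSup_induction p (motive := P) (hp ▸ Submodule.mem_top) mem
    (mem (Classical.arbitrary ι) 0 (Submodule.zero_mem _)) add

theorem IsVOAModule.iSup_wt (h : IsVOAModule 𝒱 D) : iSup D.wt = ⊤ :=
  h.isInternal.submodule_iSup_eq_top

/-- Eigenspaces for distinct eigenvalues are independent, so only spanning has to be supplied. -/
theorem isInternal_of_le_eigenspace {E : Type*} [AddCommGroup E] [Module ℂ E] (f : Module.End ℂ E)
    {p : ℂ → Submodule ℂ E} (hp : ∀ n, p n ≤ f.eigenspace n) (htop : iSup p = ⊤) :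
    DirectSum.IsInternal p :=
  DirectSum.isInternal_submodule_of_iSupIndep_of_iSup_eq_top
    (f.eigenspaces_iSupIndep.mono hp) htop

/-- The weight spaces of a module are the eigenspaces of `L(0)`. -/
theorem IsVOAModule.mem_wt_iff (h : IsVOAModule 𝒱 D) (n : ℂ) (w : W) :
    w ∈ D.wt n ↔ D.Y 𝒱.ω 1 w = n • w := by
  refine ⟨h.L_zero n w, fun hw => ?_⟩
  have hle : ∀ n, D.wt n ≤ (D.Y 𝒱.ω 1).eigenspace n := fun n w hw =>
    Module.End.mem_eigenspace_iff.2 (h.L_zero n w hw)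
  have htop : D.wt n ⊔ ⨆ (j) (_ : j ≠ n), D.wt j = ⊤ := by
    rw [← h.iSup_wt]
    refine le_antisymm (sup_le (le_iSup _ _) (iSup₂_le fun j _ => le_iSup _ _)) ?_
    refine iSup_le fun j => ?_
    by_cases hj : j = n
    · exact hj ▸ le_sup_left
    · exact le_sup_of_le_right (le_iSup₂_of_le j hj le_rfl)
  have hd : (D.Y 𝒱.ω 1).eigenspace n ⊓ ⨆ (j) (_ : j ≠ n), D.wt j = ⊥ := by
    rw [eq_bot_iff]
    refine le_trans (inf_le_inf_left _ (iSup₂_mono fun j _ => hle j)) ?_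
    exact ((D.Y 𝒱.ω 1).eigenspaces_iSupIndep n).le_bot
  have hmod : (D.Y 𝒱.ω 1).eigenspace n = D.wt n := by
    -- Modular law: the eigenspace contains `D.wt n` and meets the sum of the other weight spaces
    -- trivially, while together these span; hence it equals `D.wt n`.
    have e := sup_inf_assoc_of_le (⨆ (j) (_ : j ≠ n), D.wt j) (hle n)
    rw [htop, top_inf_eq, inf_comm, hd, sup_bot_eq] at e
    exact e
  rw [← hmod, Module.End.mem_eigenspace_iff]
  exact hw

theorem ringChoose_natCast_cast (l j : ℕ) :
    ((Ring.choose (l : ℤ) j : ℤ) : ℂ) = (l.choose j : ℂ) := by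
  rw [Ring.choose_natCast]
  simp

/-- The commutator formula `[L(0), v_n] = (L(0)v)_n - (n+1) v_n`. -/
theorem IsVOAModule.L_zero_commutator (h : IsVOAModule 𝒱 D) (a : V) (n : ℤ) (w : W) :
    D.Y 𝒱.ω 1 (D.Y a n w) - D.Y a n (D.Y 𝒱.ω 1 w)
      = D.Y (𝒱.Y 𝒱.ω 1 a) n w - ((n : ℂ) + 1) • D.Y a n w := by
  -- With `l = 0` the left side is the commutator; with `m = 1` the right side has two terms, `(ω_0
  -- a)_{n+1} = -(n+1) a_n` and `(ω_1 a)_n`.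
  have e := h.jacobi 𝒱.ω a w 0 1 n
  have c0 : ∀ j : ℕ, j ≠ 0 → ((Ring.choose (0 : ℤ) j : ℤ) : ℂ) = 0 := fun j hj => by
    have := ringChoose_natCast_cast 0 j
    rw [Nat.cast_zero] at this
    rw [this, Nat.choose_eq_zero_of_lt (Nat.pos_of_ne_zero hj), Nat.cast_zero]
  rw [finsum_eq_single _ 0 (fun j hj => by rw [c0 j hj]; simp),
    finsum_eq_single _ 0 (fun j hj => by rw [c0 j hj]; simp),
    finsum_eq_sum_of_support_subset (s := Finset.range 2) _ ?_] at e
  · have c1 : ∀ i : ℕ, ((Ring.choose (1 : ℤ) i : ℤ) : ℂ) = (Nat.choose 1 i : ℂ) := fun i => by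
      have := ringChoose_natCast_cast 1 i
      rwa [Nat.cast_one] at this
    simp only [Finset.sum_range_succ, Finset.sum_range_zero, c1] at e
    simp only [Ring.choose_zero_right, Nat.cast_zero, Nat.cast_one, Nat.choose_self,
      Nat.choose_zero_right, pow_zero, Int.cast_one, one_mul, one_smul, add_zero, zero_add,
      sub_zero, zero_add] at e
    have z0 : (-1 : ℂ) ^ (0 : ℤ) = 1 := zpow_zero _
    rw [z0, one_mul, one_smul, h.derivative a (1 + n), show (1 + n - 1 : ℤ) = n by ring] at e
    rw [e]
    rw [LinearMap.smul_apply]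
    push_cast
    module
  · intro i hi
    by_contra hlt
    simp only [Finset.coe_range, Set.mem_Iio, not_lt] at hlt
    apply hi
    have := ringChoose_natCast_cast 1 i
    rw [Nat.cast_one] at this
    simp only [this, Nat.choose_eq_zero_of_lt (show 1 < i by omega), Nat.cast_zero, zero_smul]

/-- If `v` has weight `d`, then `v_n` maps `W_(q)` into `W_(q+d-n-1)`. -/
theorem IsVOAModule.Y_mem_wt (h : IsVOAModule 𝒱 D) {a : V} {d : ℤ} (ha : a ∈ 𝒱.wt d) (n : ℤ)
    {q : ℂ} {w : W} (hw : w ∈ D.wt q) {p : ℂ} (hp : p = q + d - n - 1) :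
    D.Y a n w ∈ D.wt p := by
  rw [h.mem_wt_iff]
  have e := h.L_zero_commutator a n w
  rw [h.L_zero q w hw, 𝒱.L_zero d a ha, map_smul, map_smul, Pi.smul_apply, LinearMap.smul_apply,
    sub_eq_iff_eq_add] at e
  rw [e, hp]
  module

/-- A linear map between modules that commutes with the action preserves the gradings. -/
def ModuleHom.ofMapY (hD : IsVOAModule 𝒱 D) (hD' : IsVOAModule 𝒱 D') (f : W →ₗ[ℂ] W')
    (hf : ∀ (a : V) (n : ℤ) (w : W), f (D.Y a n w) = D'.Y a n (f w)) : ModuleHom D D' where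
  toLinearMap := f
  map_Y := hf
  map_wt n w hw := by
    rw [hD'.mem_wt_iff, ← hf, hD.L_zero n w hw, map_smul]

end Weights

/-! ### Transfer of the module axioms along retracts -/

section Retracts

variable {V : Type u} [AddCommGroup V] [Module ℂ V] {𝒱 : VertexOperatorAlgebra V}

/-- Truncation makes the sums in the Jacobi identity finite, so that linear maps pass through `∑ᶠ`.
-/
theorem jacobi_support_left {W E : Type*} [AddCommGroup W] [Module ℂ W] [AddCommGroup E]
    [Module ℂ E] (Y : V →ₗ[ℂ] (ℤ → Module.End ℂ W))
    (hY : ∀ (a : V) (w : W), ∃ N : ℤ, ∀ n ≥ N, Y a n w = 0) (b : V) (w : W) (n : ℤ)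
    (c : ℕ → ℂ) (f : ℕ → W →ₗ[ℂ] E) :
    (Function.support fun j : ℕ => c j • f j (Y b (n + j) w)).Finite := by
  obtain ⟨N, hN⟩ := exists_nat_truncation (hY b w) n
  exact finite_support_of_eventually_zero ⟨N, fun j hj => by simp [hN j hj]⟩

/-- A finite family of module maps `e j : M j → W` and `p j : W → M j` with `∑ e j ∘ p j = 1`
transfers the module axioms from the `M j` to `W`. -/
theorem IsVOAModule.of_retract {W : Type*} [AddCommGroup W] [Module ℂ W] {D : ModuleData V W}
    {ι : Type*} [Fintype ι] {M : ι → Type*} [∀ i, AddCommGroup (M i)] [∀ i, Module ℂ (M i)]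
    {DM : ∀ i, ModuleData V (M i)} (hM : ∀ i, IsVOAModule 𝒱 (DM i))
    (e : ∀ i, ModuleHom (DM i) D) (p : ∀ i, ModuleHom D (DM i))
    (hep : ∀ w, ∑ i, (e i).toLinearMap ((p i).toLinearMap w) = w) : IsVOAModule 𝒱 D := by
  -- The `p i` are jointly injective, so every identity can be checked after applying them; the `e
  -- i` are needed only for spanning.
  have inj : ∀ {w w' : W}, (∀ i, (p i).toLinearMap w = (p i).toLinearMap w') → w = w' := by
    intro w w' h
    rw [← hep w, ← hep w']
    exact Finset.sum_congr rfl fun i _ => by rw [h i]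
  have eqv : ∀ n, ∀ w ∈ D.wt n, D.Y 𝒱.ω 1 w = n • w := fun n w hw => inj fun i => by
    rw [(p i).map_Y, map_smul, (hM i).L_zero n _ ((p i).map_wt n w hw)]
  have trunc : ∀ (a : V) (w : W), ∃ N : ℤ, ∀ n ≥ N, D.Y a n w = 0 := by
    intro a w
    choose N hN using fun i => (hM i).truncation a ((p i).toLinearMap w)
    obtain ⟨B, hB⟩ := (Set.finite_range N).bddAbove
    refine ⟨B, fun n hn => inj fun i => ?_⟩
    rw [(p i).map_Y, hN i n ((hB ⟨i, rfl⟩).trans hn), map_zero]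
  refine
    { isInternal := ?_, truncation := trunc, vacuum := ?_, jacobi := ?_, virasoro := ?_,
      derivative := ?_, L_zero := eqv, wt_lower := ?_, wt_finite := ?_ }
  · refine isInternal_of_le_eigenspace (D.Y 𝒱.ω 1)
      (fun n w hw => Module.End.mem_eigenspace_iff.2 (eqv n w hw)) (eq_top_iff.2 fun w _ => ?_)
    rw [← hep w]
    refine Submodule.sum_mem _ fun i _ => ?_
    refine iSup_wt_induction (hM i).iSup_wt (P := fun x => (e i).toLinearMap x ∈ iSup D.wt)
      (fun n x hx => Submodule.mem_iSup_of_mem n ((e i).map_wt n x hx)) (fun x y hx hy => ?_) _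
    rw [map_add]
    exact Submodule.add_mem _ hx hy
  · intro n w
    refine inj fun i => ?_
    rw [(p i).map_Y, (hM i).vacuum]
    split_ifs <;> simp
  · intro a b w l m n
    refine inj fun i => ?_
    have J := (hM i).jacobi a b ((p i).toLinearMap w) l m n
    rw [map_sub]
    have s1 := jacobi_support_left D.Y trunc b w n
      (fun j => (-1 : ℂ) ^ j * ((Ring.choose l j : ℤ) : ℂ)) (fun j => D.Y a (l + m - j))
    have s2 := jacobi_support_left D.Y trunc a w m
      (fun j => (-1 : ℂ) ^ (l + j) * ((Ring.choose l j : ℤ) : ℂ)) (fun j => D.Y b (l + n - j))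
    -- The right-hand sum truncates inside `V` itself, so the linear maps here are `v ↦ v_{m+n-j}
    -- w`.
    have s3 := jacobi_support_left 𝒱.Y 𝒱.truncation a b l
      (fun j => ((Ring.choose m j : ℤ) : ℂ))
      (fun j => (LinearMap.applyₗ w) ∘ₗ (LinearMap.proj (m + n - j)) ∘ₗ D.Y)
    rw [map_finsum _ s1, map_finsum _ s2]
    refine Eq.trans ?_ (J.trans ?_)
    · simp only [map_smul, ModuleHom.map_Y]
    · refine Eq.trans ?_ (map_finsum (p i).toLinearMap s3).symm
      simp [ModuleHom.map_Y]
  · intro m n w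
    refine inj fun i => ?_
    simp only [map_sub, map_add, map_smul, (p i).map_Y]
    exact (hM i).virasoro m n _
  · intro a n
    refine LinearMap.ext fun w => inj fun i => ?_
    rw [(p i).map_Y, (hM i).derivative]
    simp [(p i).map_Y]
  · intro n
    choose N hN using fun i => (hM i).wt_lower n
    obtain ⟨B, hB⟩ := (Set.finite_range N).bddBelow
    refine ⟨B, fun k hk => (Submodule.eq_bot_iff _).2 fun w hw => inj fun i => ?_⟩
    have := (p i).map_wt _ w hw
    rw [hN i k (hk.trans_le (hB ⟨i, rfl⟩)), Submodule.mem_bot] at this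
    rw [this, map_zero]
  · intro n
    have := fun i => (hM i).wt_finite n
    refine Module.Finite.of_injective
      (LinearMap.pi fun i => (p i).toLinearMap.restrict ((p i).map_wt n)) fun x y hxy => ?_
    exact Subtype.ext (inj fun i => congrArg Subtype.val (congrFun hxy i))

end Retracts

/-! ### Schur's lemma -/

section Schur

variable {V : Type u} [AddCommGroup V] [Module ℂ V] {𝒱 : VertexOperatorAlgebra V}
  {W W' : Type*} [AddCommGroup W] [Module ℂ W] [AddCommGroup W'] [Module ℂ W']
  {D : ModuleData V W} {D' : ModuleData V W'}

theorem IsIrreducibleModule.eq_bot_or_eq_top (h : IsIrreducibleModule D) {N : Submodule ℂ W}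
    (hN : IsStable D N) : N = ⊥ ∨ N = ⊤ :=
  h.2.2 N le_top hN

theorem IsIrreducibleModule.exists_wt_ne_bot (h : IsIrreducibleModule D) (hD : IsVOAModule 𝒱 D) :
    ∃ n, D.wt n ≠ ⊥ := by
  by_contra! hbot
  exact h.2.1 (by rw [← hD.iSup_wt, iSup_eq_bot.2 hbot])

/-- Schur's lemma: the endomorphisms of an irreducible module are scalars. -/
theorem IsIrreducibleModule.exists_eq_smul (h : IsIrreducibleModule D) (hD : IsVOAModule 𝒱 D)
    (η : ModuleHom D D) : ∃ t : ℂ, ∀ w, η.toLinearMap w = t • w := by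
  obtain ⟨n, hn⟩ := h.exists_wt_ne_bot hD
  have := hD.wt_finite n
  have : Nontrivial (D.wt n) := Submodule.nontrivial_iff_ne_bot.2 hn
  -- A nonzero weight space is finite-dimensional over `ℂ` and preserved by `η`. The kernel of `η -
  -- t` is then a nonzero submodule, hence everything.
  obtain ⟨t, ht⟩ := Module.End.exists_eigenvalue (η.toLinearMap.restrict (η.map_wt n))
  obtain ⟨x, hx⟩ := ht.exists_hasEigenvector
  refine ⟨t, ?_⟩
  have hst : IsStable D (LinearMap.ker (η.toLinearMap - t • LinearMap.id)) := by
    intro a m w hw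
    simp only [LinearMap.mem_ker, LinearMap.sub_apply, LinearMap.smul_apply, LinearMap.id_apply,
      sub_eq_zero] at hw ⊢
    rw [η.map_Y, hw, map_smul]
  have hmem : (x : W) ∈ LinearMap.ker (η.toLinearMap - t • LinearMap.id) := by
    have := congrArg Subtype.val hx.apply_eq_smul
    simpa [sub_eq_zero] using this
  rcases h.eq_bot_or_eq_top hst with hb | htop
  · rw [hb, Submodule.mem_bot] at hmem
    exact absurd (Subtype.ext hmem) hx.2
  · intro w
    have : w ∈ LinearMap.ker (η.toLinearMap - t • LinearMap.id) := htop ▸ Submodule.mem_top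
    simpa [sub_eq_zero] using this

/-- Schur's lemma: module maps between inequivalent irreducible modules vanish. -/
theorem IsIrreducibleModule.map_eq_zero (h : IsIrreducibleModule D) (h' : IsIrreducibleModule D')
    (hD : IsVOAModule 𝒱 D) (hD' : IsVOAModule 𝒱 D') (hne : ¬ ModuleIso D D')
    (η : ModuleHom D D') (w : W) : η.toLinearMap w = 0 := by
  rcases h.eq_bot_or_eq_top η.ker_isStable with hk | hk
  · rcases h'.eq_bot_or_eq_top η.range_isStable with hr | hr
    · have : η.toLinearMap w ∈ LinearMap.range η.toLinearMap := ⟨w, rfl⟩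
      rwa [hr, Submodule.mem_bot] at this
    · let f := LinearEquiv.ofBijective η.toLinearMap
        ⟨LinearMap.ker_eq_bot.1 hk, LinearMap.range_eq_top.1 hr⟩
      -- The inverse preserves gradings automatically, since it commutes with `L(0)`.
      refine absurd ⟨η, ModuleHom.ofMapY hD' hD f.symm.toLinearMap fun a n w' => ?_,
        f.symm_apply_apply, f.apply_symm_apply⟩ hne
      have : D'.Y a n w' = f (D.Y a n (f.symm w')) :=
        ((η.map_Y a n _).trans (congrArg _ (f.apply_symm_apply w'))).symm
      simp [this]
  · exact LinearMap.mem_ker.1 (hk ▸ Submodule.mem_top)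

end Schur

/-! ### Finite decomposition into irreducible summands -/

section Submodules

variable {V : Type u} [AddCommGroup V] [Module ℂ V] {𝒱 : VertexOperatorAlgebra V}
  {W : Type*} [AddCommGroup W] [Module ℂ W] {D : ModuleData V W}

/-- The structure induced on a submodule. -/
def ModuleData.restrict (D : ModuleData V W) {N : Submodule ℂ W} (hN : IsStable D N) :
    ModuleData V N where
  Y :=
    { toFun := fun a n => (D.Y a n).restrict (hN a n)
      map_add' := fun a b => by ext; simp
      map_smul' := fun t a => by ext; simp }
  wt n := (D.wt n).comap N.subtype

/-- The inclusion of a submodule. -/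
def ModuleHom.subtype {N : Submodule ℂ W} (hN : IsStable D N) :
    ModuleHom (D.restrict hN) D where
  toLinearMap := N.subtype
  map_Y _ _ _ := rfl
  map_wt _ _ hw := hw

theorem IsIrreducibleSubmodule.restrict {N : Submodule ℂ W} (h : IsIrreducibleSubmodule D N) :
    IsIrreducibleModule (D.restrict h.1) := by
  refine ⟨fun _ _ _ _ => Submodule.mem_top, ?_, fun N' _ hN' => ?_⟩
  · have : Nontrivial N := Submodule.nontrivial_iff_ne_bot.2 h.2.1
    exact top_ne_bot
  · have hst : IsStable D (N'.map N.subtype) := by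
      rintro a n _ ⟨w, hw, rfl⟩
      exact ⟨_, hN' a n w hw, rfl⟩
    rcases h.2.2 _ (Submodule.map_subtype_le N N') hst with hb | ht
    · exact Or.inl (Submodule.map_injective_of_injective N.injective_subtype
        (hb.trans (Submodule.map_bot _).symm))
    · right
      refine Submodule.map_injective_of_injective N.injective_subtype ?_
      rw [ht, Submodule.map_top, Submodule.range_subtype]

/-- The projection onto a summand of a direct sum decomposition. -/
def DirectSum.IsInternal.projection {ι R E : Type*} [DecidableEq ι] [Ring R]
    [AddCommGroup E] [Module R E]
    {A : ι → Submodule R E} (h : DirectSum.IsInternal A) (i : ι) : E →ₗ[R] A i :=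
  DirectSum.component R ι (fun i => A i) i ∘ₗ
    (LinearEquiv.ofBijective (DirectSum.coeLinearMap A) h).symm.toLinearMap

theorem DirectSum.IsInternal.projection_of_mem {ι R E : Type*} [DecidableEq ι] [Ring R]
    [AddCommGroup E]
    [Module R E] {A : ι → Submodule R E} (h : DirectSum.IsInternal A) {i j : ι} {x : E}
    (hx : x ∈ A j) : (h.projection i x : E) = if i = j then x else 0 := by
  split_ifs with hij
  · subst hij
    exact congrArg Subtype.val (h.ofBijective_coeLinearMap_same ⟨x, hx⟩)
  · exact congrArg Subtype.val (h.ofBijective_coeLinearMap_of_ne (Ne.symm hij) ⟨x, hx⟩)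

theorem DirectSum.IsInternal.sum_projection {ι R E : Type*} [DecidableEq ι] [Fintype ι] [Ring R]
    [AddCommGroup E]
    [Module R E] {A : ι → Submodule R E} (h : DirectSum.IsInternal A) (x : E) :
    ∑ i, (h.projection i x : E) = x := by
  refine Submodule.iSup_induction A (motive := fun x => ∑ i, (h.projection i x : E) = x)
    (h.submodule_iSup_eq_top ▸ Submodule.mem_top : x ∈ iSup A) (fun j x hx => ?_) (by simp)
    (fun x y hx hy => ?_)
  · simp [h.projection_of_mem hx]
  · simp only [map_add, Submodule.coe_add, Finset.sum_add_distrib, hx, hy]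

/-- On each stable summand the projection is the identity or zero, and both commute with the modes.
-/
theorem projection_map_Y {ι : Type*} [DecidableEq ι] {A : ι → Submodule ℂ W}
    (h : DirectSum.IsInternal A)
    (hA : ∀ i, IsStable D (A i)) (i : ι) (a : V) (n : ℤ) (w : W) :
    (h.projection i (D.Y a n w) : W) = D.Y a n (h.projection i w) := by
  refine Submodule.iSup_induction A
    (motive := fun w => (h.projection i (D.Y a n w) : W) = D.Y a n (h.projection i w))
    (h.submodule_iSup_eq_top ▸ Submodule.mem_top : w ∈ iSup A) (fun j x hx => ?_) (by simp)
    (fun x y hx hy => ?_)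
  · rw [h.projection_of_mem hx, h.projection_of_mem (hA j a n x hx)]
    split_ifs <;> simp
  · simp only [map_add, Submodule.coe_add, hx, hy]

/-- The projection onto a direct summand, as a module map. -/
def ModuleHom.projection {ι : Type*} [DecidableEq ι] {A : ι → Submodule ℂ W}
    (h : DirectSum.IsInternal A)
    (hA : ∀ i, IsStable D (A i)) (hD : IsVOAModule 𝒱 D) (i : ι) :
    ModuleHom D (D.restrict (hA i)) where
  toLinearMap := h.projection i
  map_Y a n w := Subtype.ext (projection_map_Y h hA i a n w)
  map_wt n w hw := by
    refine (hD.mem_wt_iff n _).2 ?_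
    rw [Submodule.subtype_apply, ← projection_map_Y h hA, hD.L_zero n w hw, map_smul]
    rfl

theorem IsVOAModule.restrict {ι : Type*} [DecidableEq ι] {A : ι → Submodule ℂ W}
    (h : DirectSum.IsInternal A)
    (hA : ∀ i, IsStable D (A i)) (hD : IsVOAModule 𝒱 D) (i : ι) :
    IsVOAModule 𝒱 (D.restrict (hA i)) := by
  refine .of_retract (fun _ : Unit => hD) (fun _ => ModuleHom.projection h hA hD i)
    (fun _ => ModuleHom.subtype (hA i)) fun w => ?_
  refine (Fintype.sum_unique _).trans (Subtype.ext ?_)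
  exact (h.projection_of_mem w.2).trans (if_pos rfl)

/-- Nonzero vectors taken from independent submodules are linearly independent, and a
finite-dimensional weight space holds only finitely many of these. -/
theorem finite_of_inf_wt_ne_bot (hD : IsVOAModule 𝒱 D) {ι : Type*} {A : ι → Submodule ℂ W}
    (h : iSupIndep A) (n : ℂ) : {i | A i ⊓ D.wt n ≠ ⊥}.Finite := by
  have := hD.wt_finite n
  choose x hx hx0 using fun i : {i | A i ⊓ D.wt n ≠ ⊥} => Submodule.exists_mem_ne_zero_of_ne_bot i.2
  have hli : LinearIndependent ℂ x :=
    (h.comp Subtype.val_injective).linearIndependent _ (fun i => (hx i).1) hx0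
  have hli' : LinearIndependent ℂ (fun i => (⟨x i, (hx i).2⟩ : D.wt n)) :=
    LinearIndependent.of_comp (D.wt n).subtype hli
  exact Set.finite_coe_iff.1 hli'.finite

/-- A completely reducible module is a finite direct sum of modules among the `M i`. -/
theorem IsIrreducibleSystem.exists_decomposition {k : ℕ} {M : Fin k → VOAModule.{u, v} 𝒱}
    (hM : IsIrreducibleSystem M) (W : VOAModule.{u, v} 𝒱) (hW : IsCompletelyReducible W.data) :
    ∃ (ι : Type v) (_ : Fintype ι) (i : ι → Fin k)
      (e : ∀ j, ModuleHom (M (i j)).data W.data) (p : ∀ j, ModuleHom W.data (M (i j)).data),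
      ∀ w, ∑ j, (e j).toLinearMap ((p j).toLinearMap w) = w := by
  classical
  obtain ⟨S, hS, hind, htop⟩ := hW
  have hint : DirectSum.IsInternal (fun N : S => (N : Submodule ℂ W)) :=
    DirectSum.isInternal_submodule_of_iSupIndep_of_iSup_eq_top hind
      (by rw [← sSup_eq_iSup', htop])
  have hst : ∀ N : S, IsStable W.data (N : Submodule ℂ W) := fun N => (hS N N.2).1
  have hmod : ∀ N : S, IsVOAModule 𝒱 (W.data.restrict (hst N)) := fun N =>
    IsVOAModule.restrict hint hst W.isModule N
  choose i f g hgf hfg using fun N : S =>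
    hM.complete ⟨_, _, hmod N⟩ (hS N N.2).restrict
  choose n hn using fun j => (hM.irreducible j).exists_wt_ne_bot (M j).isModule
  -- A summand equivalent to `M j` meets the weight space of weight `n j`, where `M j` is nonzero.
  -- There are finitely many `j`, and each such weight space meets finitely many summands.
  have hfin : Finite S := by
    refine Set.finite_univ_iff.1 (Set.Finite.subset (Set.finite_iUnion fun j =>
      finite_of_inf_wt_ne_bot W.isModule hind (n j)) fun N _ => Set.mem_iUnion.2 ⟨i N, ?_⟩)
    obtain ⟨x, hx, hx0⟩ := Submodule.exists_mem_ne_zero_of_ne_bot (hn (i N))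
    refine (Submodule.ne_bot_iff _).2 ⟨(g N).toLinearMap x,
      ⟨((g N).toLinearMap x).2, (g N).map_wt _ x hx⟩, fun h0 => hx0 ?_⟩
    have h1 : (g N).toLinearMap x = 0 := Subtype.ext h0
    rw [← hfg N x, h1, map_zero]
  have := Fintype.ofFinite S
  refine ⟨S, this, i, fun N => (ModuleHom.subtype (hst N)).comp (g N),
    fun N => (f N).comp (ModuleHom.projection hint hst W.isModule N), fun w => ?_⟩
  refine Eq.trans (Finset.sum_congr rfl fun N _ => ?_) (hint.sum_projection w)
  exact congrArg Subtype.val (hgf N _)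

end Submodules

/-! ### From `P(z)`-intertwining maps to intertwining operators -/

section FusionRules

variable {V : Type u} [AddCommGroup V] [Module ℂ V] {𝒱 : VertexOperatorAlgebra V}

theorem decomp_of_mem {a : V} {d : ℤ} (ha : a ∈ 𝒱.wt d) :
    𝒱.decomp a = DirectSum.of (fun n => 𝒱.wt n) d ⟨a, ha⟩ := by
  rw [VertexOperatorAlgebra.decomp, LinearEquiv.symm_apply_eq]
  exact (DirectSum.coeLinearMap_of 𝒱.wt d ⟨a, ha⟩).symm

/-- A homogeneous `a` contributes a single summand. The weight `q` is a variable with an equation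
because components lie in types depending on the weight, where rewriting is awkward. -/
theorem completionAct_of_mem {W : VOAModule.{u, v} 𝒱} {a : V} {d : ℤ} (ha : a ∈ 𝒱.wt d) (n : ℤ)
    (x : Completion W.data) {p q : ℂ} (hq : q = p - d + n + 1) :
    completionAct a n x p = W.data.Y a n (x q) := by
  classical
  subst hq
  rw [completionAct, Finset.sum_subset (s₂ := {d})]
  · rw [Finset.sum_singleton, decomp_of_mem ha, DirectSum.of_eq_same]
  · rw [decomp_of_mem ha]
    intro k hk
    by_contra hne
    rw [Finset.mem_singleton] at hne
    exact (DFinsupp.mem_support_iff.1 hk) (DirectSum.of_eq_of_ne _ _ _ hne)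
  · intro k _ hk
    rw [DFinsupp.notMem_support_iff.1 hk]
    simp

variable (W₁ W₂ : VOAModule.{u, v} 𝒱)

/-- The linear map on `W₁ ⊗ W₂` that agrees with `B h₁ h₂` on `(W₁)_(h₁) ⊗ (W₂)_(h₂)`. -/
def gradedMap {E : Type*} [AddCommGroup E] [Module ℂ E] (B : ℂ → ℂ → (W₁ ⊗[ℂ] W₂ →ₗ[ℂ] E)) :
    W₁ ⊗[ℂ] W₂ →ₗ[ℂ] E :=
  DirectSum.toModule ℂ (ℂ × ℂ) E (fun h => B h.1 h.2 ∘ₗ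
      TensorProduct.map (W₁.data.wt h.1).subtype (W₂.data.wt h.2).subtype) ∘ₗ
    (TensorProduct.directSum ℂ ℂ (fun h => W₁.data.wt h) (fun h => W₂.data.wt h)).toLinearMap ∘ₗ
    TensorProduct.map
      (LinearEquiv.ofBijective (DirectSum.coeLinearMap W₁.data.wt)
        W₁.isModule.isInternal).symm.toLinearMap
      (LinearEquiv.ofBijective (DirectSum.coeLinearMap W₂.data.wt)
        W₂.isModule.isInternal).symm.toLinearMap

variable {W₁ W₂}

theorem decomposition_symm_of_mem {ι R E : Type*} [DecidableEq ι] [Ring R] [AddCommGroup E]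
    [Module R E] {A : ι → Submodule R E} (h : DirectSum.IsInternal A) {i : ι} {x : E}
    (hx : x ∈ A i) :
    (LinearEquiv.ofBijective (DirectSum.coeLinearMap A) h).symm x
      = DirectSum.lof R ι (fun i => A i) i ⟨x, hx⟩ := by
  rw [LinearEquiv.symm_apply_eq]
  exact (DirectSum.coeLinearMap_lof A i ⟨x, hx⟩).symm

theorem gradedMap_tmul {E : Type*} [AddCommGroup E] [Module ℂ E]
    (B : ℂ → ℂ → (W₁ ⊗[ℂ] W₂ →ₗ[ℂ] E)) {h₁ h₂ : ℂ} {w₁ : W₁} {w₂ : W₂}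
    (hw₁ : w₁ ∈ W₁.data.wt h₁) (hw₂ : w₂ ∈ W₂.data.wt h₂) :
    gradedMap W₁ W₂ B (w₁ ⊗ₜ w₂) = B h₁ h₂ (w₁ ⊗ₜ w₂) := by
  rw [gradedMap, LinearMap.comp_apply, LinearMap.comp_apply, TensorProduct.map_tmul,
    LinearEquiv.coe_coe, LinearEquiv.coe_coe, LinearEquiv.coe_coe,
    decomposition_symm_of_mem _ hw₁, decomposition_symm_of_mem _ hw₂,
    TensorProduct.directSum_lof_tmul_lof, DirectSum.toModule_lof]
  rfl

theorem homogeneous_tensor_ext {E : Type*} [AddCommGroup E] [Module ℂ E]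
    {f g : W₁ ⊗[ℂ] W₂ →ₗ[ℂ] E}
    (h : ∀ h₁, ∀ w₁ ∈ W₁.data.wt h₁, ∀ h₂, ∀ w₂ ∈ W₂.data.wt h₂, f (w₁ ⊗ₜ w₂) = g (w₁ ⊗ₜ w₂)) :
    f = g := by
  refine TensorProduct.ext' fun w₁ w₂ => ?_
  refine iSup_wt_induction W₁.isModule.iSup_wt
    (P := fun w₁ => f (w₁ ⊗ₜ w₂) = g (w₁ ⊗ₜ w₂)) (fun h₁ w₁ hw₁ => ?_)
    (fun x y hx hy => by rw [TensorProduct.add_tmul, map_add, map_add, hx, hy]) w₁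
  exact iSup_wt_induction W₂.isModule.iSup_wt
    (P := fun w₂ => f (w₁ ⊗ₜ w₂) = g (w₁ ⊗ₜ w₂)) (h h₁ w₁ hw₁)
    (fun x y hx hy => by rw [TensorProduct.tmul_add, map_add, map_add, hx, hy]) w₂

/-- The power `z^s` for the principal branch of the logarithm. -/
def branchPow (z s : ℂ) : ℂ := Complex.exp (s * Complex.log z)

theorem branchPow_ne_zero (z s : ℂ) : branchPow z s ≠ 0 := Complex.exp_ne_zero _

/-- The only property of the branch needed besides nonvanishing: all the identities below shift
exponents by integers. -/
theorem branchPow_add_int {z : ℂ} (hz : z ≠ 0) (s : ℂ) (n : ℤ) :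
    branchPow z (s + n) = z ^ n * branchPow z s := by
  rw [branchPow, branchPow, add_mul, Complex.exp_add, Complex.exp_int_mul, Complex.exp_log hz,
    mul_comm]

variable {W₃ : VOAModule.{u, v} 𝒱}

/-- The operator attached to a `P(z)`-intertwining map `I`: for homogeneous `w₁`, `w₂` of weights
`h₁`, `h₂`, the coefficient of `x^{-n-1}` in `𝒴(w₁,x)w₂` is
`z^{n+1} π_{h₁+h₂-n-1} I(w₁ ⊗ w₂)`. -/
def intertwiningOperatorOfMap (z : ℂ) (I : W₁ ⊗[ℂ] W₂ →ₗ[ℂ] Completion W₃.data) :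
    W₁ ⊗[ℂ] W₂ →ₗ[ℂ] (ℂ → ℕ →₀ W₃) :=
  gradedMap W₁ W₂ fun h₁ h₂ => LinearMap.pi fun n =>
    Finsupp.lsingle 0 ∘ₗ (branchPow z (n + 1) • (W₃.data.wt (h₁ + h₂ - n - 1)).subtype) ∘ₗ
      Completion.proj W₃.data (h₁ + h₂ - n - 1) ∘ₗ I

theorem intertwiningOperatorOfMap_apply (z : ℂ) (I : W₁ ⊗[ℂ] W₂ →ₗ[ℂ] Completion W₃.data)
    {h₁ h₂ : ℂ} {w₁ : W₁} {w₂ : W₂} (hw₁ : w₁ ∈ W₁.data.wt h₁) (hw₂ : w₂ ∈ W₂.data.wt h₂)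
    {n p : ℂ} (hp : p = h₁ + h₂ - n - 1) :
    intertwiningOperatorOfMap z I (w₁ ⊗ₜ w₂) n
      = Finsupp.single 0 (branchPow z (n + 1) • (I (w₁ ⊗ₜ w₂) p : W₃)) := by
  subst hp
  rw [intertwiningOperatorOfMap, gradedMap_tmul _ hw₁ hw₂]
  rfl

theorem intertwiningOperatorOfMap_truncation (z : ℂ) {I : W₁ ⊗[ℂ] W₂ →ₗ[ℂ] Completion W₃.data}
    (hI : IsPzIntertwiningMap z W₁ W₂ W₃ I) (w₁ : W₁) (w₂ : W₂) (n : ℂ) :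
    ∃ N : ℕ, ∀ m : ℕ, m ≥ N → intertwiningOperatorOfMap z I (w₁ ⊗ₜ w₂) (n + m) = 0 := by
  have add : ∀ {f g h : ℕ → (ℕ →₀ W₃)}, (∃ N : ℕ, ∀ m ≥ N, f m = 0) → (∃ N : ℕ, ∀ m ≥ N, g m = 0) →
      (∀ m, h m = f m + g m) → ∃ N : ℕ, ∀ m ≥ N, h m = 0 := by
    rintro f g h ⟨N, hN⟩ ⟨M, hM⟩ hfg
    exact ⟨max N M, fun m hm => by
      rw [hfg, hN m (le_of_max_le_left hm), hM m (le_of_max_le_right hm), add_zero]⟩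
  refine iSup_wt_induction W₁.isModule.iSup_wt
    (P := fun w₁ => ∃ N : ℕ, ∀ m : ℕ, m ≥ N →
      intertwiningOperatorOfMap z I (w₁ ⊗ₜ w₂) (n + m) = 0) (fun h₁ w₁ hw₁ => ?_)
    (fun x y hx hy => add hx hy fun m => by
      rw [TensorProduct.add_tmul, map_add, Pi.add_apply]) w₁
  refine iSup_wt_induction W₂.isModule.iSup_wt
    (P := fun w₂ => ∃ N : ℕ, ∀ m : ℕ, m ≥ N →
      intertwiningOperatorOfMap z I (w₁ ⊗ₜ w₂) (n + m) = 0) (fun h₂ w₂ hw₂ => ?_)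
    (fun x y hx hy => add hx hy fun m => by
      rw [TensorProduct.tmul_add, map_add, Pi.add_apply]) w₂
  obtain ⟨N, hN⟩ := hI.truncation w₁ w₂ (h₁ + h₂ - n - 1)
  refine ⟨N, fun m hm => ?_⟩
  rw [intertwiningOperatorOfMap_apply z I hw₁ hw₂ (p := h₁ + h₂ - n - 1 - m) (by ring), hN m hm]
  simp

/-- No logarithms occur, which disposes of every coefficient with `k > 0`. -/
theorem intertwiningOperatorOfMap_succ (z : ℂ) (I : W₁ ⊗[ℂ] W₂ →ₗ[ℂ] Completion W₃.data)
    (t : W₁ ⊗[ℂ] W₂) (n : ℂ) (k : ℕ) : intertwiningOperatorOfMap z I t n (k + 1) = 0 := by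
  have : (Finsupp.lapply (R := ℂ) (k + 1)) ∘ₗ (LinearMap.proj n) ∘ₗ
      intertwiningOperatorOfMap z I = 0 := by
    refine homogeneous_tensor_ext fun h₁ w₁ hw₁ h₂ w₂ hw₂ => ?_
    simp [intertwiningOperatorOfMap_apply z I hw₁ hw₂ rfl]
  exact LinearMap.congr_fun this t

/-- The Jacobi identity for intertwining operators extends additively in each argument. -/
theorem intertwining_jacobi_of_homogeneous {𝒴 : W₁ ⊗[ℂ] W₂ →ₗ[ℂ] (ℂ → ℕ →₀ W₃)}
    (trunc : ∀ (w₁ : W₁) (w₂ : W₂) (n : ℂ), ∃ N : ℕ, ∀ m : ℕ, m ≥ N → 𝒴 (w₁ ⊗ₜ w₂) (n + m) = 0)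
    (l m : ℤ) (n : ℂ) (k : ℕ)
    (H : ∀ d, ∀ a ∈ 𝒱.wt d, ∀ h₁, ∀ w₁ ∈ W₁.data.wt h₁, ∀ h₂, ∀ w₂ ∈ W₂.data.wt h₂,
      (∑ᶠ j : ℕ, ((-1 : ℂ) ^ j * ((Ring.choose l j : ℤ) : ℂ)) •
          W₃.data.Y a (l + m - j) (𝒴 (w₁ ⊗ₜ w₂) (n + j) k))
        - (∑ᶠ j : ℕ, ((-1 : ℂ) ^ (l + j) * ((Ring.choose l j : ℤ) : ℂ)) •
            𝒴 (w₁ ⊗ₜ W₂.data.Y a (m + j) w₂) (l + n - j) k)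
      = ∑ᶠ i : ℕ, ((Ring.choose m i : ℤ) : ℂ) • 𝒴 (W₁.data.Y a (l + i) w₁ ⊗ₜ w₂) (m + n - i) k)
    (a : V) (w₁ : W₁) (w₂ : W₂) :
    (∑ᶠ j : ℕ, ((-1 : ℂ) ^ j * ((Ring.choose l j : ℤ) : ℂ)) •
        W₃.data.Y a (l + m - j) (𝒴 (w₁ ⊗ₜ w₂) (n + j) k))
      - (∑ᶠ j : ℕ, ((-1 : ℂ) ^ (l + j) * ((Ring.choose l j : ℤ) : ℂ)) •
          𝒴 (w₁ ⊗ₜ W₂.data.Y a (m + j) w₂) (l + n - j) k)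
    = ∑ᶠ i : ℕ, ((Ring.choose m i : ℤ) : ℂ) • 𝒴 (W₁.data.Y a (l + i) w₁ ⊗ₜ w₂) (m + n - i) k := by
  -- Additivity of `∑ᶠ` requires finite supports, for arbitrary and not only homogeneous arguments.
  have fin₁ : ∀ (a : V) (w₁ : W₁) (w₂ : W₂),
      (Function.support fun j : ℕ => ((-1 : ℂ) ^ j * ((Ring.choose l j : ℤ) : ℂ)) •
        W₃.data.Y a (l + m - j) (𝒴 (w₁ ⊗ₜ w₂) (n + j) k)).Finite := by
    intro a w₁ w₂
    obtain ⟨N, hN⟩ := trunc w₁ w₂ n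
    exact finite_support_of_eventually_zero ⟨N, fun j hj => by simp [hN j hj]⟩
  have fin₂ : ∀ (a : V) (w₁ : W₁) (w₂ : W₂),
      (Function.support fun j : ℕ => ((-1 : ℂ) ^ (l + j) * ((Ring.choose l j : ℤ) : ℂ)) •
        𝒴 (w₁ ⊗ₜ W₂.data.Y a (m + j) w₂) (l + n - j) k).Finite := by
    intro a w₁ w₂
    obtain ⟨N, hN⟩ := exists_nat_truncation (W₂.isModule.truncation a w₂) m
    exact finite_support_of_eventually_zero ⟨N, fun j hj => by simp [hN j hj]⟩
  have fin₃ : ∀ (a : V) (w₁ : W₁) (w₂ : W₂),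
      (Function.support fun i : ℕ => ((Ring.choose m i : ℤ) : ℂ) •
        𝒴 (W₁.data.Y a (l + i) w₁ ⊗ₜ w₂) (m + n - i) k).Finite := by
    intro a w₁ w₂
    obtain ⟨N, hN⟩ := exists_nat_truncation (W₁.isModule.truncation a w₁) l
    exact finite_support_of_eventually_zero ⟨N, fun j hj => by simp [hN j hj]⟩
  induction a using iSup_wt_induction 𝒱.isInternal.submodule_iSup_eq_top with
  | add a b ha hb =>
    have e := congrArg₂ (· + ·) ha hb
    simp only [map_add, Pi.add_apply, LinearMap.add_apply, TensorProduct.add_tmul,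
      TensorProduct.tmul_add, Finsupp.add_apply, smul_add]
    rw [finsum_add_distrib (fin₁ ..) (fin₁ ..), finsum_add_distrib (fin₂ ..) (fin₂ ..),
      finsum_add_distrib (fin₃ ..) (fin₃ ..), ← e]
    abel
  | mem d a ha =>
    induction w₁ using iSup_wt_induction W₁.isModule.iSup_wt with
    | add x y hx hy =>
      have e := congrArg₂ (· + ·) hx hy
      simp only [map_add, Pi.add_apply, TensorProduct.add_tmul, Finsupp.add_apply, smul_add]
      rw [finsum_add_distrib (fin₁ ..) (fin₁ ..), finsum_add_distrib (fin₂ ..) (fin₂ ..),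
        finsum_add_distrib (fin₃ ..) (fin₃ ..), ← e]
      abel
    | mem h₁ w₁ hw₁ =>
      induction w₂ using iSup_wt_induction W₂.isModule.iSup_wt with
      | add x y hx hy =>
        have e := congrArg₂ (· + ·) hx hy
        simp only [map_add, Pi.add_apply, TensorProduct.tmul_add, Finsupp.add_apply, smul_add]
        rw [finsum_add_distrib (fin₁ ..) (fin₁ ..), finsum_add_distrib (fin₂ ..) (fin₂ ..),
          finsum_add_distrib (fin₃ ..) (fin₃ ..), ← e]
        abel
      | mem h₂ w₂ hw₂ => exact H d a ha h₁ w₁ hw₁ h₂ w₂ hw₂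

theorem intertwiningOperatorOfMap_jacobi {z : ℂ} (hz : z ≠ 0)
    {I : W₁ ⊗[ℂ] W₂ →ₗ[ℂ] Completion W₃.data} (hI : IsPzIntertwiningMap z W₁ W₂ W₃ I)
    (a : V) (w₁ : W₁) (w₂ : W₂) (l m : ℤ) (n : ℂ) (k : ℕ) :
    (∑ᶠ j : ℕ, ((-1 : ℂ) ^ j * ((Ring.choose l j : ℤ) : ℂ)) •
        W₃.data.Y a (l + m - j) (intertwiningOperatorOfMap z I (w₁ ⊗ₜ w₂) (n + j) k))
      - (∑ᶠ j : ℕ, ((-1 : ℂ) ^ (l + j) * ((Ring.choose l j : ℤ) : ℂ)) •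
          intertwiningOperatorOfMap z I (w₁ ⊗ₜ W₂.data.Y a (m + j) w₂) (l + n - j) k)
    = ∑ᶠ i : ℕ, ((Ring.choose m i : ℤ) : ℂ) •
        intertwiningOperatorOfMap z I (W₁.data.Y a (l + i) w₁ ⊗ₜ w₂) (m + n - i) k := by
  cases k with
  | succ k => simp [intertwiningOperatorOfMap_succ]
  | zero =>
  refine intertwining_jacobi_of_homogeneous (intertwiningOperatorOfMap_truncation z hI) l m n 0
    (fun d a ha h₁ w₁ hw₁ h₂ w₂ hw₂ => ?_) a w₁ w₂
  -- This weight is shared by all terms of the desired identity, whatever the summation index. After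
  -- multiplication by `z^{n+1}`, the powers `z^j`, `z^{m-i}`, `z^{l-j}` become the index shifts
  -- `n+j`, `m+n-i`, `l+n-j`.
  have J := congrArg (branchPow z (n + 1) • ·)
    (hI.jacobi a w₁ w₂ l m (h₁ + h₂ + d - n - l - m - 2))
  simp only [smul_add, smul_finsum] at J
  rw [sub_eq_iff_eq_add]
  refine Eq.trans ?_ (J.trans (congrArg₂ (· + ·) ?_ ?_))
  · refine finsum_congr fun j => ?_
    rw [intertwiningOperatorOfMap_apply z I hw₁ hw₂ rfl, Finsupp.single_eq_same,
      completionAct_of_mem ha _ _ (q := h₁ + h₂ - (n + j) - 1) (by push_cast; ring),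
      map_smul, smul_smul, smul_smul]
    congr 1
    rw [show n + (j : ℂ) + 1 = n + 1 + ((j : ℤ) : ℂ) by push_cast; ring, branchPow_add_int hz,
      zpow_natCast, neg_pow z j]
    ring
  · refine finsum_congr fun j => ?_
    rw [intertwiningOperatorOfMap_apply z I
      (W₁.isModule.Y_mem_wt ha (l + j) hw₁ rfl) hw₂
      (p := h₁ + h₂ + d - n - l - m - 2) (by push_cast; ring), Finsupp.single_eq_same,
      smul_smul, smul_smul]
    congr 1
    rw [show (m : ℂ) + n - j + 1 = n + 1 + ((m - j : ℤ) : ℂ) by push_cast; ring,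
      branchPow_add_int hz]
    ring
  · refine finsum_congr fun j => ?_
    rw [intertwiningOperatorOfMap_apply z I hw₁
      (W₂.isModule.Y_mem_wt ha (m + j) hw₂ rfl)
      (p := h₁ + h₂ + d - n - l - m - 2) (by push_cast; ring), Finsupp.single_eq_same,
      smul_smul, smul_smul]
    congr 1
    rw [show (l : ℂ) + n - j + 1 = n + 1 + ((l - j : ℤ) : ℂ) by push_cast; ring,
      branchPow_add_int hz]
    ring

/-- Combining the `L(-1)`- and `L(0)`-bracket relations:
`z I(L(-1)w₁ ⊗ w₂) = (p - h₁ - h₂) I(w₁ ⊗ w₂)` in weight `p`. -/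
theorem IsPzIntertwiningMap.L_neg_one {z : ℂ} {I : W₁ ⊗[ℂ] W₂ →ₗ[ℂ] Completion W₃.data}
    (hI : IsPzIntertwiningMap z W₁ W₂ W₃ I) {h₁ h₂ : ℂ} {w₁ : W₁} {w₂ : W₂}
    (hw₁ : w₁ ∈ W₁.data.wt h₁) (hw₂ : w₂ ∈ W₂.data.wt h₂) (p : ℂ) :
    z • (I (W₁.data.Y 𝒱.ω 0 w₁ ⊗ₜ w₂) p : W₃) = (p - h₁ - h₂) • (I (w₁ ⊗ₜ w₂) p : W₃) := by
  -- Only the relation for `L(0)` is used: its term `i = 1` is `z I(L(-1)w₁ ⊗ w₂)`, and the other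
  -- terms are scalars times `I(w₁ ⊗ w₂)`.
  have B := hI.bracket w₁ w₂ 1 (by norm_num) p
  rw [completionAct_of_mem 𝒱.ω_mem _ _ (q := p) (by push_cast; ring)] at B
  simp only [Finset.sum_range_succ, Finset.sum_range_zero, Nat.cast_one, Nat.cast_zero, sub_self,
    sub_zero, Nat.choose_zero_right, Nat.choose_self, pow_zero, pow_one, one_mul, one_smul,
    zero_add] at B
  rw [W₃.isModule.L_zero p _ (I (w₁ ⊗ₜ w₂) p).2, W₁.isModule.L_zero _ _ hw₁,
    W₂.isModule.L_zero _ _ hw₂, TensorProduct.tmul_smul, ← TensorProduct.smul_tmul', map_smul,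
    map_smul, Completion.smul_apply, Completion.smul_apply, Submodule.coe_smul,
    Submodule.coe_smul] at B
  rw [sub_smul, sub_smul, B]
  abel

theorem isLogIntertwiningOperator_ofMap {z : ℂ} (hz : z ≠ 0)
    {I : W₁ ⊗[ℂ] W₂ →ₗ[ℂ] Completion W₃.data} (hI : IsPzIntertwiningMap z W₁ W₂ W₃ I) :
    IsLogIntertwiningOperator W₁ W₂ W₃ (intertwiningOperatorOfMap z I) := by
  refine ⟨intertwiningOperatorOfMap_truncation z hI, intertwiningOperatorOfMap_jacobi hz hI,
    fun w₁ w₂ n k => ?_, fun w₁ w₂ s hs n k => ?_⟩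
  · rw [intertwiningOperatorOfMap_succ, smul_zero, add_zero]
    cases k with
    | succ k => simp [intertwiningOperatorOfMap_succ]
    | zero =>
    -- Stated as an equality of linear maps on `W₁ ⊗ W₂`, the relation may be checked on homogeneous
    -- vectors.
    have : (Finsupp.lapply (R := ℂ) 0) ∘ₗ (LinearMap.proj n) ∘ₗ intertwiningOperatorOfMap z I ∘ₗ
          LinearMap.rTensor W₂ (W₁.data.Y 𝒱.ω 0)
        = (-n) • (Finsupp.lapply (R := ℂ) 0) ∘ₗ (LinearMap.proj (n - 1)) ∘ₗ
          intertwiningOperatorOfMap z I := by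
      refine homogeneous_tensor_ext fun h₁ w₁ hw₁ h₂ w₂ hw₂ => ?_
      simp only [LinearMap.comp_apply, LinearMap.smul_apply, LinearMap.proj_apply,
        LinearMap.rTensor_tmul, Finsupp.lapply_apply]
      rw [intertwiningOperatorOfMap_apply z I (W₁.isModule.Y_mem_wt 𝒱.ω_mem 0 hw₁ rfl) hw₂
          (p := h₁ + h₂ - n) (by push_cast; ring),
        intertwiningOperatorOfMap_apply z I hw₁ hw₂ (p := h₁ + h₂ - n) (by ring),
        Finsupp.single_eq_same, Finsupp.single_eq_same]
      -- At this weight the scalar `p - h₁ - h₂` is `-n`, as the derivative property demands; one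
      -- factor `z` of `z^{n+1}` is spent on it.
      have L := hI.L_neg_one hw₁ hw₂ (h₁ + h₂ - n)
      rw [show n + 1 = (n - 1 + 1) + ((1 : ℤ) : ℂ) by push_cast; ring, branchPow_add_int hz,
        zpow_one, mul_comm, mul_smul, L, smul_smul, smul_smul]
      congr 1
      ring
    exact LinearMap.congr_fun this (w₁ ⊗ₜ w₂)
  · cases k with
    | succ k => simp [intertwiningOperatorOfMap_succ]
    | zero =>
    have : W₃.data.Y 𝒱.ω s ∘ₗ (Finsupp.lapply (R := ℂ) 0) ∘ₗ (LinearMap.proj n) ∘ₗ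
          intertwiningOperatorOfMap z I
        - (Finsupp.lapply (R := ℂ) 0) ∘ₗ (LinearMap.proj n) ∘ₗ intertwiningOperatorOfMap z I ∘ₗ
          LinearMap.lTensor W₁ (W₂.data.Y 𝒱.ω s)
        = ∑ i ∈ Finset.range (s + 1), (s.choose i : ℂ) • (Finsupp.lapply (R := ℂ) 0) ∘ₗ
          (LinearMap.proj (n + i)) ∘ₗ intertwiningOperatorOfMap z I ∘ₗ
          LinearMap.rTensor W₂ (W₁.data.Y 𝒱.ω (s - i)) := by
      refine homogeneous_tensor_ext fun h₁ w₁ hw₁ h₂ w₂ hw₂ => ?_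
      simp only [LinearMap.comp_apply, LinearMap.sub_apply, LinearMap.sum_apply,
        LinearMap.smul_apply, LinearMap.proj_apply, LinearMap.rTensor_tmul,
        LinearMap.lTensor_tmul, Finsupp.lapply_apply]
      -- `ω_s` lowers weight by `s - 1`, taking weight `h₁ + h₂ - n - 1` to this one; the factor
      -- `z^i` becomes the shift `n + i`.
      have B := congrArg (branchPow z (n + 1) • ·) (hI.bracket w₁ w₂ s hs (h₁ + h₂ - n - s))
      simp only [smul_add, Finset.smul_sum] at B
      rw [completionAct_of_mem 𝒱.ω_mem _ _ (q := h₁ + h₂ - n - 1) (by push_cast; ring)] at B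
      rw [sub_eq_iff_eq_add, add_comm]
      rw [intertwiningOperatorOfMap_apply z I hw₁ hw₂ rfl,
        intertwiningOperatorOfMap_apply z I hw₁ (W₂.isModule.Y_mem_wt 𝒱.ω_mem s hw₂ rfl)
          (p := h₁ + h₂ - n - s) (by push_cast; ring),
        Finsupp.single_eq_same, Finsupp.single_eq_same, map_smul, B]
      congr 1
      refine Finset.sum_congr rfl fun i _ => ?_
      rw [intertwiningOperatorOfMap_apply z I (W₁.isModule.Y_mem_wt 𝒱.ω_mem _ hw₁ rfl) hw₂
          (p := h₁ + h₂ - n - s) (by push_cast; ring), Finsupp.single_eq_same, smul_smul, smul_smul]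
      congr 1
      rw [show n + (i : ℂ) + 1 = n + 1 + ((i : ℤ) : ℂ) by push_cast; ring, branchPow_add_int hz,
        zpow_natCast]
      ring
    have e := LinearMap.congr_fun this (w₁ ⊗ₜ w₂)
    simpa only [LinearMap.comp_apply, LinearMap.sub_apply, LinearMap.sum_apply,
        LinearMap.smul_apply, LinearMap.proj_apply, LinearMap.rTensor_tmul,
        LinearMap.lTensor_tmul, Finsupp.lapply_apply] using e

variable (W₁ W₂ W₃) in
/-- The embedding of the `P(z)`-intertwining maps into the logarithmic intertwining operators. -/
def intertwiningOperatorEmbedding {z : ℂ} (hz : z ≠ 0) :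
    pzIntertwiningMaps z W₁ W₂ W₃ →ₗ[ℂ] logIntertwiningOperators W₁ W₂ W₃ where
  toFun I := ⟨intertwiningOperatorOfMap z I.1, isLogIntertwiningOperator_ofMap hz I.2⟩
  map_add' I J := Subtype.ext <| homogeneous_tensor_ext fun h₁ w₁ hw₁ h₂ w₂ hw₂ => funext fun n => by
    simp [intertwiningOperatorOfMap_apply z _ hw₁ hw₂ rfl]
  map_smul' t I := Subtype.ext <| homogeneous_tensor_ext fun h₁ w₁ hw₁ h₂ w₂ hw₂ => funext fun n => by
    simp [intertwiningOperatorOfMap_apply z _ hw₁ hw₂ rfl, smul_comm t]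

theorem intertwiningOperatorEmbedding_injective {z : ℂ} (hz : z ≠ 0) :
    Function.Injective (intertwiningOperatorEmbedding W₁ W₂ W₃ hz) := by
  intro I J hIJ
  refine Subtype.ext (homogeneous_tensor_ext fun h₁ w₁ hw₁ h₂ w₂ hw₂ =>
    Completion.ext' fun p => ?_)
  -- The mode of index `h₁ + h₂ - p - 1` carries the weight `p` component, up to a nonzero power of
  -- `z`.
  have e := DFunLike.congr_fun (congrFun (LinearMap.congr_fun (congrArg Subtype.val hIJ)
    (w₁ ⊗ₜ[ℂ] w₂)) (h₁ + h₂ - p - 1)) 0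
  have e' : ∀ K : pzIntertwiningMaps z W₁ W₂ W₃,
      (intertwiningOperatorEmbedding W₁ W₂ W₃ hz K).1 (w₁ ⊗ₜ[ℂ] w₂) (h₁ + h₂ - p - 1) 0
        = branchPow z (h₁ + h₂ - p - 1 + 1) • (K.1 (w₁ ⊗ₜ w₂) p : W₃) := fun K => by
    refine (DFunLike.congr_fun (intertwiningOperatorOfMap_apply z K.1 hw₁ hw₂ (p := p)
      (by ring)) 0).trans Finsupp.single_eq_same
  rw [e', e'] at e
  exact smul_right_injective _ (branchPow_ne_zero z _) e

theorem FinitelyReductive.finite_pzIntertwiningMaps (h : FinitelyReductive.{u, v} 𝒱) {z : ℂ}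
    (hz : z ≠ 0) (W₁ W₂ W₃ : VOAModule.{u, v} 𝒱) :
    Module.Finite ℂ (pzIntertwiningMaps z W₁ W₂ W₃) := by
  let _ : AddCommGroup (logIntertwiningOperators W₁ W₂ W₃) := Submodule.addCommGroup _
  have : IsNoetherian ℂ (logIntertwiningOperators W₁ W₂ W₃) :=
    IsNoetherian.iff_fg.2 (h.finite_fusion W₁ W₂ W₃)
  exact Module.Finite.of_injective _ (intertwiningOperatorEmbedding_injective hz)

end FusionRules

/-! ### The module structure on `∐ᵢ Uᵢ ⊗ Wᵢ` -/

section Constructions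

variable {V : Type u} [AddCommGroup V] [Module ℂ V]

/-- The module map `w ↦ f ⊗ w`. -/
def ModuleHom.tensorInsert {W U : Type*} [AddCommGroup W] [Module ℂ W] [AddCommGroup U]
    [Module ℂ U] (D : ModuleData V W) (f : U) : ModuleHom D (D.tensorLeft U) where
  toLinearMap := TensorProduct.mk ℂ U W f
  map_Y _ _ _ := rfl
  map_wt _ w hw := ⟨f ⊗ₜ ⟨w, hw⟩, rfl⟩

/-- The module map `f ⊗ w ↦ φ(f) w`. -/
def ModuleHom.contract {W U : Type*} [AddCommGroup W] [Module ℂ W] [AddCommGroup U]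
    [Module ℂ U] (D : ModuleData V W) (φ : Module.Dual ℂ U) : ModuleHom (D.tensorLeft U) D where
  toLinearMap := (TensorProduct.lid ℂ W).toLinearMap ∘ₗ LinearMap.rTensor W φ
  map_Y a n w := by
    induction w using TensorProduct.induction_on with
    | zero => simp
    | add x y hx hy => simp only [map_add, hx, hy]
    | tmul f w => simp [ModuleData.tensorLeft]
  map_wt n := by
    rintro _ ⟨x, rfl⟩
    induction x using TensorProduct.induction_on with
    | zero => simp
    | add x y hx hy =>
      rw [map_add, map_add]
      exact Submodule.add_mem _ hx hy
    | tmul f w => exact Submodule.smul_mem _ (φ f) w.2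

theorem ModuleHom.contract_tmul {W U : Type*} [AddCommGroup W] [Module ℂ W] [AddCommGroup U]
    [Module ℂ U] (D : ModuleData V W) (φ : Module.Dual ℂ U) (f : U) (w : W) :
    (ModuleHom.contract D φ).toLinearMap (f ⊗ₜ w) = φ f • w := rfl

/-- The projections of a direct sum, as module maps. -/
def ModuleHom.component {ι : Type*} {W : ι → Type*} [∀ i, AddCommGroup (W i)]
    [∀ i, Module ℂ (W i)] (D : ∀ i, ModuleData V (W i)) (i : ι) :
    ModuleHom (ModuleData.directSum D) (D i) where
  toLinearMap := DirectSum.component ℂ ι W i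
  map_Y a n w := DirectSum.lmap_apply (fun i => (D i).Y a n) w i
  map_wt _ _ hw := (Submodule.mem_iInf _).1 hw i

theorem ModuleHom.component_inclusion {ι : Type*} [DecidableEq ι] {W : ι → Type*}
    [∀ i, AddCommGroup (W i)] [∀ i, Module ℂ (W i)] (D : ∀ i, ModuleData V (W i)) (i : ι)
    (w : W i) : (component D i).toLinearMap ((inclusion D i).toLinearMap w) = w :=
  DirectSum.component.lof_self ℂ i w

theorem ModuleHom.component_inclusion_of_ne {ι : Type*} [DecidableEq ι] {W : ι → Type*}
    [∀ i, AddCommGroup (W i)] [∀ i, Module ℂ (W i)] (D : ∀ i, ModuleData V (W i)) {i j : ι}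
    (h : j ≠ i) (w : W j) :
    (component D i).toLinearMap ((inclusion D j).toLinearMap w) = 0 :=
  (DirectSum.component.of ℂ i j w).trans (dif_neg h)

theorem ModuleHom.sum_inclusion_component {ι : Type*} [DecidableEq ι] [Fintype ι] {W : ι → Type*}
    [∀ i, AddCommGroup (W i)] [∀ i, Module ℂ (W i)] (D : ∀ i, ModuleData V (W i)) (x : ⨁ i, W i) :
    ∑ i, (inclusion D i).toLinearMap ((component D i).toLinearMap x) = x :=
  DirectSum.sum_univ_of x

/-- Dual bases resolve the identity of `U`, splitting `U ⊗ W` into copies of `W`; this is the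
retract datum for the tensor factors. -/
theorem sum_tmul_contract {W U κ : Type*} [AddCommGroup W] [Module ℂ W] [AddCommGroup U]
    [Module ℂ U] [Fintype κ] (D : ModuleData V W) (b : Module.Basis κ ℂ U) (x : U ⊗[ℂ] W) :
    ∑ s, (ModuleHom.tensorInsert D (b s)).toLinearMap
      ((ModuleHom.contract D (b.coord s)).toLinearMap x) = x := by
  induction x using TensorProduct.induction_on with
  | zero => simp
  | add x y hx hy => simp only [map_add, Finset.sum_add_distrib, hx, hy]
  | tmul f w =>
    simp only [ModuleHom.contract_tmul, map_smul]
    simp only [ModuleHom.tensorInsert, TensorProduct.mk_apply, TensorProduct.smul_tmul',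
      ← TensorProduct.sum_tmul, Module.Basis.coord_apply]
    rw [b.sum_repr]

variable {𝒱 : VertexOperatorAlgebra V}

/-- A finite direct sum of modules `U i ⊗ W i`, with `U i` finite-dimensional, is a module. -/
theorem IsVOAModule.directSum_tensorLeft {ι : Type*} [Fintype ι] {W U : ι → Type*}
    [∀ i, AddCommGroup (W i)] [∀ i, Module ℂ (W i)] [∀ i, AddCommGroup (U i)]
    [∀ i, Module ℂ (U i)] [∀ i, Module.Finite ℂ (U i)] {D : ∀ i, ModuleData V (W i)}
    (hD : ∀ i, IsVOAModule 𝒱 (D i)) :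
    IsVOAModule 𝒱 (ModuleData.directSum fun i => (D i).tensorLeft (U i)) := by
  classical
  let b i := Module.finBasis ℂ (U i)
  refine .of_retract (ι := Σ i, Fin (Module.finrank ℂ (U i))) (fun j => hD j.1)
    (fun j => (ModuleHom.inclusion (fun i => (D i).tensorLeft (U i)) j.1).comp
      (ModuleHom.tensorInsert (D j.1) (b j.1 j.2)))
    (fun j => (ModuleHom.contract (D j.1) ((b j.1).coord j.2)).comp
      (ModuleHom.component (fun i => (D i).tensorLeft (U i)) j.1))
    fun x => ?_
  rw [Fintype.sum_sigma]
  refine Eq.trans (Finset.sum_congr rfl fun i _ => ?_) 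
    (ModuleHom.sum_inclusion_component (fun i => (D i).tensorLeft (U i)) x)
  simp only [ModuleHom.comp_apply]
  exact (map_sum (ModuleHom.inclusion (fun i => (D i).tensorLeft (U i)) i).toLinearMap _ _).symm.trans
    (congrArg _ (sum_tmul_contract (D i) (b i) _))

end Constructions

/-! ### The universal property -/

section TensorProduct

variable {V : Type u} [AddCommGroup V] [Module ℂ V] {𝒱 : VertexOperatorAlgebra V}
  {z : ℂ} {W₁ W₂ : VOAModule.{u, v} 𝒱}

theorem completionAct_completionMap {W W' : VOAModule.{u, v} 𝒱} (η : ModuleHom W.data W'.data)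
    (a : V) (n : ℤ) (x : Completion W.data) (p : ℂ) :
    completionAct a n (η.completionMap x) p = η.toLinearMap (completionAct a n x p) := by
  simp only [completionAct, map_sum, η.map_Y, ModuleHom.completionMap_apply]

/-- `P(z)`-intertwining maps may be composed with module maps. -/
theorem completionMap_comp_mem {W W' : VOAModule.{u, v} 𝒱} (η : ModuleHom W.data W'.data)
    {I : W₁ ⊗[ℂ] W₂ →ₗ[ℂ] Completion W.data} (hI : I ∈ pzIntertwiningMaps z W₁ W₂ W) :
    η.completionMap ∘ₗ I ∈ pzIntertwiningMaps z W₁ W₂ W' := by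
  refine ⟨fun w₁ w₂ n => ?_, fun a w₁ w₂ l m p => ?_, fun w₁ w₂ s hs p => ?_⟩
  · obtain ⟨N, hN⟩ := hI.truncation w₁ w₂ n
    refine ⟨N, fun m hm => Subtype.ext ?_⟩
    rw [LinearMap.comp_apply, ModuleHom.completionMap_apply, hN m hm]
    exact map_zero _
  · have J := congrArg η.toLinearMap (hI.jacobi a w₁ w₂ l m p)
    rw [map_add] at J
    -- The three sums are finite, so `η` may be applied term by term.
    obtain ⟨N₁, hN₁⟩ := completionAct_truncation a (l + m) _ p (hI.truncation w₁ w₂)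
    obtain ⟨N₂, hN₂⟩ := exists_nat_truncation (W₁.isModule.truncation a w₁) l
    obtain ⟨N₃, hN₃⟩ := exists_nat_truncation (W₂.isModule.truncation a w₂) m
    rw [map_finsum _ (finite_support_of_eventually_zero
        ⟨N₁, fun j hj => by simp [hN₁ j hj]⟩),
      map_finsum _ (finite_support_of_eventually_zero ⟨N₂, fun j hj => by simp [hN₂ j hj]⟩),
      map_finsum _ (finite_support_of_eventually_zero ⟨N₃, fun j hj => by simp [hN₃ j hj]⟩)] at J
    simpa only [map_smul, LinearMap.comp_apply, completionAct_completionMap,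
      ModuleHom.completionMap_apply] using J
  · have B := congrArg η.toLinearMap (hI.bracket w₁ w₂ s hs p)
    simpa only [map_smul, map_add, map_sum, LinearMap.comp_apply, completionAct_completionMap,
      ModuleHom.completionMap_apply] using B

/-- The evaluation map is the canonical element `∑ b_s* ⊗ b_s` of `ℳ* ⊗ ℳ`, corresponding to the
identity of `ℳ`. -/
theorem pzEvaluation_apply {κ : Type*} [Fintype κ] {W₃ : VOAModule.{u, v} 𝒱}
    [Module.Finite ℂ (pzIntertwiningMaps z W₁ W₂ W₃)]
    (b : Module.Basis κ ℂ (pzIntertwiningMaps z W₁ W₂ W₃)) (t : W₁ ⊗[ℂ] W₂) (n : ℂ) :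
    (pzEvaluation z W₁ W₂ W₃ t n : Module.Dual ℂ (pzIntertwiningMaps z W₁ W₂ W₃) ⊗[ℂ] W₃)
      = ∑ s, b.coord s ⊗ₜ[ℂ] ((b s).1 t n : W₃) := by
  have e : (dualTensorHomEquiv ℂ (pzIntertwiningMaps z W₁ W₂ W₃) (W₃.data.wt n)).symm
      (Completion.proj W₃.data n ∘ₗ (pzIntertwiningMaps z W₁ W₂ W₃).subtype.flip t)
      = ∑ s, b.coord s ⊗ₜ[ℂ] ((b s).1 t n) := by
    refine (LinearEquiv.symm_apply_eq _).2 (LinearMap.ext fun K => ?_)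
    change _ = dualTensorHom ℂ _ _ (∑ s, b.coord s ⊗ₜ[ℂ] ((b s).1 t n)) K
    rw [map_sum, LinearMap.sum_apply]
    conv_lhs => rw [← b.sum_repr K, map_sum]
    refine Finset.sum_congr rfl fun s _ => ?_
    rw [map_smul]
    rfl
  refine (congrArg (LinearMap.lTensor _ (W₃.data.wt n).subtype) e).trans ?_
  rw [map_sum]
  rfl

variable {k : ℕ} {M : Fin k → VOAModule.{u, v} 𝒱}

variable (z W₁ W₂ M) in
/-- The module map `∐ᵢ ℳᵢ* ⊗ Mᵢ → Mᵢ` given by evaluation at `K ∈ ℳᵢ`. -/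
def pzContract (i : Fin k) (K : pzIntertwiningMaps z W₁ W₂ (M i)) :
    ModuleHom (pzTensorData z W₁ W₂ M) (M i).data :=
  (ModuleHom.contract (M i).data (Module.Dual.eval ℂ _ K)).comp (ModuleHom.component _ i)

theorem pzContract_inclusion (i : Fin k) (K : pzIntertwiningMaps z W₁ W₂ (M i))
    (y : Module.Dual ℂ (pzIntertwiningMaps z W₁ W₂ (M i)) ⊗[ℂ] (M i)) :
    (pzContract z W₁ W₂ M i K).toLinearMap ((ModuleHom.inclusion (fun i => (M i).data.tensorLeft
      (Module.Dual ℂ (pzIntertwiningMaps z W₁ W₂ (M i)))) i).toLinearMap y)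
      = (ModuleHom.contract (M i).data (Module.Dual.eval ℂ _ K)).toLinearMap y :=
  congrArg (ModuleHom.contract (M i).data (Module.Dual.eval ℂ _ K)).toLinearMap
    (ModuleHom.component_inclusion (fun i => (M i).data.tensorLeft
      (Module.Dual ℂ (pzIntertwiningMaps z W₁ W₂ (M i)))) i y)

theorem pzContract_inclusion_of_ne {i j : Fin k} (h : j ≠ i)
    (K : pzIntertwiningMaps z W₁ W₂ (M i))
    (y : Module.Dual ℂ (pzIntertwiningMaps z W₁ W₂ (M j)) ⊗[ℂ] (M j)) :
    (pzContract z W₁ W₂ M i K).toLinearMap ((ModuleHom.inclusion (fun i => (M i).data.tensorLeft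
      (Module.Dual ℂ (pzIntertwiningMaps z W₁ W₂ (M i)))) j).toLinearMap y) = 0 :=
  (congrArg (ModuleHom.contract (M i).data (Module.Dual.eval ℂ _ K)).toLinearMap
    (ModuleHom.component_inclusion_of_ne (fun i => (M i).data.tensorLeft
      (Module.Dual ℂ (pzIntertwiningMaps z W₁ W₂ (M i)))) h y)).trans (map_zero _)

variable (z W₁ W₂ M) in
/-- The module map `Mⱼ → ∐ᵢ ℳᵢ* ⊗ Mᵢ` given by `w ↦ f ⊗ w`. -/
def pzInsert (j : Fin k) (f : Module.Dual ℂ (pzIntertwiningMaps z W₁ W₂ (M j))) :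
    ModuleHom (M j).data (pzTensorData z W₁ W₂ M) :=
  (ModuleHom.inclusion (fun i => (M i).data.tensorLeft
    (Module.Dual ℂ (pzIntertwiningMaps z W₁ W₂ (M i)))) j).comp
    (ModuleHom.tensorInsert (M j).data f)

variable [∀ i, Module.Finite ℂ (pzIntertwiningMaps z W₁ W₂ (M i))]

theorem pzTensorMap_apply (t : W₁ ⊗[ℂ] W₂) (n : ℂ) :
    (pzTensorMap z W₁ W₂ M t n :
        ⨁ i, Module.Dual ℂ (pzIntertwiningMaps z W₁ W₂ (M i)) ⊗[ℂ] (M i))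
      = ∑ i, (ModuleHom.inclusion (fun i => (M i).data.tensorLeft
          (Module.Dual ℂ (pzIntertwiningMaps z W₁ W₂ (M i)))) i).toLinearMap
          (pzEvaluation z W₁ W₂ (M i) t n) := by
  exact Completion.coe_linearMap_sum_apply _ _ t n

/-- Evaluation at `K` kills the other summands and turns `∑ b_s* ⊗ b_s` into `∑ b_s*(K) b_s = K`.
This gives existence for the target `M i` and shows that `K` is determined by its module map. -/
theorem pzContract_comp_pzTensorMap (i : Fin k) (K : pzIntertwiningMaps z W₁ W₂ (M i)) :
    (pzContract z W₁ W₂ M i K).completionMap ∘ₗ pzTensorMap z W₁ W₂ M = K.1 := by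
  refine LinearMap.ext fun t => Completion.ext' fun n => ?_
  rw [LinearMap.comp_apply, ModuleHom.completionMap_apply, pzTensorMap_apply, map_sum,
    Finset.sum_eq_single i]
  · rw [pzContract_inclusion, pzEvaluation_apply (Module.finBasis ℂ (pzIntertwiningMaps z W₁ W₂ (M i))), map_sum]
    set b := Module.finBasis ℂ (pzIntertwiningMaps z W₁ W₂ (M i))
    have e := congrArg (fun L => ((L.1 t n : (M i).data.wt n) : M i)) (b.sum_repr K)
    refine Eq.trans ?_ e
    let ev : pzIntertwiningMaps z W₁ W₂ (M i) →ₗ[ℂ] M i :=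
      (((M i).data.wt n).subtype ∘ₗ Completion.proj (M i).data n ∘ₗ LinearMap.applyₗ t) ∘ₗ
        (pzIntertwiningMaps z W₁ W₂ (M i)).subtype
    change _ = ev (∑ s, b.repr K s • b s)
    rw [map_sum]
    refine Finset.sum_congr rfl fun s _ => ?_
    rw [ModuleHom.contract_tmul, map_smul]
    rfl
  · intro j _ hj
    exact pzContract_inclusion_of_ne hj K _
  · exact fun h => absurd (Finset.mem_univ i) h

variable (z W₁ W₂ M) in
-- In bases, the canonical map is a finite sum of basis elements `b_s` followed by the module maps
-- `w ↦ b_s* ⊗ w`, and intertwining maps are closed under both operations.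
theorem pzTensorMap_mem (hM : IsVOAModule 𝒱 (pzTensorData z W₁ W₂ M)) :
    pzTensorMap z W₁ W₂ M ∈ pzIntertwiningMaps z W₁ W₂ (pzTensorModule z W₁ W₂ M hM) := by
  let b i := Module.finBasis ℂ (pzIntertwiningMaps z W₁ W₂ (M i))
  have h : pzTensorMap z W₁ W₂ M
      = ∑ i, ∑ s, (pzInsert z W₁ W₂ M i ((b i).coord s)).completionMap ∘ₗ (b i s).1 := by
    refine LinearMap.ext fun t => Completion.ext' fun n => ?_
    rw [pzTensorMap_apply]
    have e₁ := Completion.coe_linearMap_sum_apply Finset.univ (fun i => ∑ s,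
      (pzInsert z W₁ W₂ M i ((b i).coord s)).completionMap ∘ₗ (b i s).1) t n
    refine Eq.trans ?_ e₁.symm
    refine Finset.sum_congr rfl fun i _ => ?_
    have e₂ := Completion.coe_linearMap_sum_apply Finset.univ (fun s =>
      (pzInsert z W₁ W₂ M i ((b i).coord s)).completionMap ∘ₗ (b i s).1) t n
    refine Eq.trans ?_ e₂.symm
    rw [pzEvaluation_apply (b i), map_sum]
    rfl
  rw [h]
  exact Submodule.sum_mem _ fun i _ => Submodule.sum_mem _ fun s _ =>
    completionMap_comp_mem (W' := pzTensorModule z W₁ W₂ M hM)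
      (pzInsert z W₁ W₂ M i ((b i).coord s)) (b i s).2

/-- By Schur's lemma, every module map `∐ᵢ ℳᵢ* ⊗ Mᵢ → Mᵢ` is evaluation at an element of `ℳᵢ`. -/
theorem exists_eq_pzContract (hM : IsIrreducibleSystem M) (i : Fin k)
    (ψ : ModuleHom (pzTensorData z W₁ W₂ M) (M i).data) :
    ∃ K, ψ = pzContract z W₁ W₂ M i K := by
  let U j := Module.Dual ℂ (pzIntertwiningMaps z W₁ W₂ (M j))
  -- Each `f` yields an endomorphism `w ↦ ψ(f ⊗ w)` of `M i`, hence a scalar `θ f`.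
  choose θ hθ using fun f => (hM.irreducible i).exists_eq_smul (M i).isModule (ψ.comp (pzInsert z W₁ W₂ M i f))
  obtain ⟨w₀, hw₀⟩ : ∃ w : M i, w ≠ 0 := by
    by_contra! h
    exact (hM.irreducible i).2.1 ((Submodule.eq_bot_iff _).2 fun w _ => h w)
  have hθ' : ∀ f w, ψ.toLinearMap ((pzInsert z W₁ W₂ M i f).toLinearMap w) = θ f • w := hθ
  have ins_add : ∀ f g w, (pzInsert z W₁ W₂ M i (f + g)).toLinearMap w
      = (pzInsert z W₁ W₂ M i f).toLinearMap w + (pzInsert z W₁ W₂ M i g).toLinearMap w := fun f g w =>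
    
    (congrArg (ModuleHom.inclusion (fun i => (M i).data.tensorLeft (U i)) i).toLinearMap
      (TensorProduct.add_tmul f g w)).trans (map_add _ _ _)
  have ins_smul : ∀ (c : ℂ) f w, (pzInsert z W₁ W₂ M i (c • f)).toLinearMap w = c • (pzInsert z W₁ W₂ M i f).toLinearMap w :=
    fun c f w => 
      (congrArg (ModuleHom.inclusion (fun i => (M i).data.tensorLeft (U i)) i).toLinearMap
        (TensorProduct.smul_tmul' c f w).symm).trans (map_smul _ _ _)
  -- Linearity of `θ` is read off by comparing multiples of the nonzero vector `w₀`.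
  let Θ : Module.Dual ℂ (U i) :=
    { toFun := θ
      map_add' := fun f g => smul_left_injective ℂ hw₀ (by
        simp only [add_smul, ← hθ', ins_add, map_add])
      map_smul' := fun c f => smul_left_injective ℂ hw₀ (by
        simp only [RingHom.id_apply, smul_eq_mul, mul_smul, ← hθ', ins_smul, map_smul]) }
  -- Here finite-dimensionality enters: a functional on the dual is evaluation at some `K`.
  obtain ⟨K, hK⟩ := (Module.evalEquiv ℂ (pzIntertwiningMaps z W₁ W₂ (M i))).surjective Θ
  refine ⟨K, ModuleHom.ext' fun x => ?_⟩
  have key : ∀ (j : Fin k) (y : U j ⊗[ℂ] M j),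
      ψ.toLinearMap ((ModuleHom.inclusion (fun i => (M i).data.tensorLeft (U i)) j).toLinearMap y)
        = (pzContract z W₁ W₂ M i K).toLinearMap
          ((ModuleHom.inclusion (fun i => (M i).data.tensorLeft (U i)) j).toLinearMap y) := by
    intro j y
    induction y using TensorProduct.induction_on with
    | zero => simp
    | add y y' hy hy' => simp only [map_add, hy, hy']
    | tmul f w =>
      by_cases hj : j = i
      · subst hj
        rw [pzContract_inclusion, ModuleHom.contract_tmul]
        refine (hθ' f w).trans (congrArg (· • w) ?_)
        exact (LinearMap.congr_fun hK f).symm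
      · rw [pzContract_inclusion_of_ne hj]
        exact (hM.irreducible j).map_eq_zero (hM.irreducible i) (M j).isModule (M i).isModule
          (fun h => hj (hM.distinct j i h)) (ψ.comp (pzInsert z W₁ W₂ M j f)) w
  rw [← ModuleHom.sum_inclusion_component (fun i => (M i).data.tensorLeft (U i)) x]
  simp only [map_sum]
  exact Finset.sum_congr rfl fun j _ => key j _

theorem existsUnique_pzTensorMap (h𝒱 : FinitelyReductive.{u, v} 𝒱) (hM : IsIrreducibleSystem M)
    (W : VOAModule.{u, v} 𝒱) {J : W₁ ⊗[ℂ] W₂ →ₗ[ℂ] Completion W.data}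
    (hJ : J ∈ pzIntertwiningMaps z W₁ W₂ W) :
    ∃! η : ModuleHom (pzTensorData z W₁ W₂ M) W.data,
      J = η.completionMap ∘ₗ pzTensorMap z W₁ W₂ M := by
  obtain ⟨ι, _, i, e, p, hep⟩ := hM.exists_decomposition W (h𝒱.completelyReducible W)
  -- The component of `J` in the `j`-th summand determines the component of `η` there.
  let K (j : ι) : pzIntertwiningMaps z W₁ W₂ (M (i j)) :=
    ⟨(p j).completionMap ∘ₗ J, completionMap_comp_mem (p j) hJ⟩
  refine ⟨ModuleHom.sum fun j => (e j).comp (pzContract z W₁ W₂ M (i j) (K j)), ?_, ?_⟩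
  · refine LinearMap.ext fun t => Completion.ext' fun n => ?_
    rw [← hep (J t n), LinearMap.comp_apply, ModuleHom.completionMap_apply,
      ModuleHom.sum_apply]
    refine Finset.sum_congr rfl fun j _ => ?_
    rw [ModuleHom.comp_apply]
    have e := congrArg (fun L : W₁ ⊗[ℂ] W₂ →ₗ[ℂ] Completion (M (i j)).data => (L t n : M (i j)))
      (pzContract_comp_pzTensorMap (i j) (K j))
    exact congrArg _ e.symm
  · intro η hη
    refine ModuleHom.ext' fun x => ?_
    rw [ModuleHom.sum_apply, ← hep (η.toLinearMap x)]
    refine Finset.sum_congr rfl fun j _ => ?_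
    rw [ModuleHom.comp_apply]
    -- Any competitor is, after projection, evaluation at some `K'`; composing with the canonical
    -- map identifies `K'` with the component of `J`.
    obtain ⟨K', hK'⟩ := exists_eq_pzContract hM (i j) ((p j).comp η)
    have hKK' : K' = K j := by
      refine Subtype.ext ?_
      rw [← pzContract_comp_pzTensorMap (i j) K', ← hK', ModuleHom.completionMap_comp]
      exact congrArg ((p j).completionMap ∘ₗ ·) hη.symm
    rw [← hKK', ← hK']
    rfl

end TensorProduct
end

theorem proposition4p29 {V : Type u} [AddCommGroup V] [Module ℂ V]
    (𝒱 : VertexOperatorAlgebra V) (h𝒱 : FinitelyReductive.{u, v} 𝒱)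
    (z : ℂ) (hz : z ≠ 0) (W₁ W₂ : VOAModule.{u, v} 𝒱) :
    (∃ (T : VOAModule.{u, v} 𝒱) (I : W₁ ⊗[ℂ] W₂ →ₗ[ℂ] Completion T.data),
      IsPzTensorProduct z W₁ W₂ T I) ∧
    ∀ (k : ℕ) (M : Fin k → VOAModule.{u, v} 𝒱), IsIrreducibleSystem M →
      ∃ _ : ∀ i, Module.Finite ℂ (pzIntertwiningMaps z W₁ W₂ (M i)),
      ∃ hM : IsVOAModule 𝒱 (pzTensorData z W₁ W₂ M),
        IsPzTensorProduct z W₁ W₂ (pzTensorModule z W₁ W₂ M hM) (pzTensorMap z W₁ W₂ M) := by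
  have key : ∀ (k : ℕ) (M : Fin k → VOAModule.{u, v} 𝒱), IsIrreducibleSystem M →
      ∃ _ : ∀ i, Module.Finite ℂ (pzIntertwiningMaps z W₁ W₂ (M i)),
      ∃ hM : IsVOAModule 𝒱 (pzTensorData z W₁ W₂ M),
        IsPzTensorProduct z W₁ W₂ (pzTensorModule z W₁ W₂ M hM) (pzTensorMap z W₁ W₂ M) := by
    intro k M hM
    have hfin : ∀ i, Module.Finite ℂ (pzIntertwiningMaps z W₁ W₂ (M i)) := fun i =>
      h𝒱.finite_pzIntertwiningMaps hz W₁ W₂ (M i)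
    have hT : IsVOAModule 𝒱 (pzTensorData z W₁ W₂ M) :=
      IsVOAModule.directSum_tensorLeft fun i => (M i).isModule
    exact ⟨hfin, hT, pzTensorMap_mem z W₁ W₂ M hT, fun W J hJ =>
      existsUnique_pzTensorMap h𝒱 hM W hJ⟩
  refine ⟨?_, key⟩
  obtain ⟨k, M, hM⟩ := h𝒱.finite_irreducible
  obtain ⟨_, hT, h⟩ := key k M hM
  exact ⟨_, _, h⟩
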